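/- Let $(\mathcal A,\varphi)$ be a noncommutative probability space, i.e. a unital complex algebra $\mathcal A$ with a linear functional $\varphi:\mathcal A\to\mathbb C$ such that $\varphi(1)=1$. Its free cumulants $(\kappa_r)_{r\ge1}$ are defined by the moment-cumulant formula $$\varphi(a_1\cdots a_r)=\sum_{\pi\in NC(r)}\kappa_\pi[a_1,\ldots,a_r],\qquad \kappa_\pi[a_1,\ldots,a_r]=\prod_{\substack{V\in\pi\\ V=\{v_1<\cdots<v_m\}}}\kappa_m(a_{v_1},\ldots,a_{v_m}),$$ where $NC(r)$ is the set of noncrossing partitions of $\{1,\ldots,r\}$. Let $n\ge1$ and let $\{A_l\}_{l\in I}$, $A_l=(a^{(l)}_{ij})_{1\le i,j\le n}\in M_n(\mathcal A)$, be an R-cyclic family of matrices: for all $r\ge1$ and all $l_1,\ldots,l_r\in I$, $\kappa_r(a^{(l_1)}_{i_1j_1},\ldots,a^{(l_r)}_{i_rj_r})=0$ unless $j_1=i_2,\ \ldots,\ j_{r-1}=i_r$ and $j_r=i_1$. Suppose that the cumulants with cyclic indices do not depend on the indices: for all $r\ge1$ and $l_1,\ldots,l_r\in I$, the value $\kappa_r(a^{(l_1)}_{i_1i_2},a^{(l_2)}_{i_2i_3},\ldots,a^{(l_r)}_{i_ri_1})$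 is the same for all $i_1,\ldots,i_r\in\{1,\ldots,n\}$. Denote this common value by $\kappa_r[a^{(l_1)},\ldots,a^{(l_r)}]$, and for a partition $\pi$ of $\{1,\ldots,p\}$ and $\lambda\in I^p$ put $$\kappa_\pi[a^{(\lambda_1)},\ldots,a^{(\lambda_p)}]=\prod_{\substack{V\in\pi\\ V=\{v_1<\cdots<v_m\}}}\kappa_m[a^{(\lambda_{v_1})},\ldots,a^{(\lambda_{v_m})}].$$ Then for all $s\ge1$, $l_1,\ldots,l_s\in I$ and integers $p_1,\ldots,p_s\ge1$, with $p=p_1+\cdots+p_s$ and $\chi(B)=\sum_{i=1}^n B_{ii}$ the (unnormalized) trace, $$\kappa_s\bigl(\chi(A_{l_1}^{p_1}),\ldots,\chi(A_{l_s}^{p_s})\bigr)=n^{p+2-s}\sum_{\substack{\pi\in NC(p)\\ \pi\vee\gamma_{\underline p}=1_p}}n^{-|\pi|}\,\kappa_\pi\bigl[\underbrace{a^{(l_1)},\ldots,a^{(l_1)}}_{p_1},\ldots,\underbrace{a^{(l_s)},\ldots,a^{(l_s)}}_{p_s}\bigr],$$ where $|\pi|$ is the number of blocks of $\pi$, $\gamma_{\underline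 p}=\{\{1,\ldots,p_1\},\{p_1+1,\ldots,p_1+p_2\},\ldots,\{p-p_s+1,\ldots,p\}\}$, $\vee$ is the join of partitions and $1_p$ is the one-block partition. -/

import Mathlib

open scoped BigOperators

namespace FreeProb

/-- A partition of `{0, …, s - 1}`. -/
abbrev Part (s : ℕ) : Type := Finpartition (Finset.univ : Finset (Fin s))

/-- A partition is noncrossing if there are no `a < b < c < d` with `a, c` in one block
and `b, d` in a different block. -/
def IsNoncrossing {s : ℕ} (π : Part s) : Prop :=
  ∀ V ∈ π.parts, ∀ W ∈ π.parts, ∀ a b c d : Fin s,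
    a < b → b < c → c < d → a ∈ V → c ∈ V → b ∈ W → d ∈ W → V = W

open Classical in
/-- The set `NC(s)` of noncrossing partitions of `{0, …, s - 1}`. -/
noncomputable def NC (s : ℕ) : Finset (Part s) :=
  Finset.univ.filter IsNoncrossing

/-- The multiplicative extension of a sequence `f` of functions, `f r` being a function of `r`
arguments: for a partition `π`, the product over the blocks `V = {v₁ < … < v_r}` of `π` of
`f r (x v₁, …, x v_r)`. -/
noncomputable def multExt {X : Type*} (f : (r : ℕ) → (Fin r → X) → ℂ) {s : ℕ} (π : Part s)
    (x : Fin s → X) : ℂ :=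
  ∏ V ∈ π.parts, f V.card (fun t => x (V.orderEmbOfFin rfl t))

theorem card_lt_of_univ_notMem {s : ℕ} {π : Part s} (h : Finset.univ ∉ π.parts)
    {V : Finset (Fin s)} (hV : V ∈ π.parts) : V.card < s := by
  have h1 : V ≠ Finset.univ := fun e => h (e ▸ hV)
  have h2 := Finset.card_lt_univ_of_notMem
    (Classical.choose_spec (not_forall.mp fun hx => h1 (Finset.eq_univ_of_forall hx)))
  simpa using h2

open Classical in
/-- The free cumulants `κ_s` of a linear functional `φ` on a unital algebra, defined by solving the
moment-cumulant formula recursively: `κ_s(a₁, …, a_s)` is `φ(a₁ ⋯ a_s)` minus the sum of the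
`κ_π[a₁, …, a_s]` over the noncrossing partitions `π` other than the one-block partition. -/
noncomputable def freeCumulant {𝒜 : Type*} [Ring 𝒜] [Algebra ℂ 𝒜] (φ : 𝒜 →ₗ[ℂ] ℂ) (s : ℕ)
    (a : Fin s → 𝒜) : ℂ :=
  φ (List.ofFn a).prod -
    ∑ π : {π : Part s // π ∈ NC s ∧ Finset.univ ∉ π.parts},
      ∏ V : {V : Finset (Fin s) // V ∈ π.1.parts},
        freeCumulant φ V.1.card (fun t => a (V.1.orderEmbOfFin rfl t))
termination_by s
decreasing_by exact card_lt_of_univ_notMem π.2.2 V.2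

/-- The moment-cumulant formula `φ(a₁ ⋯ a_s) = ∑_{π ∈ NC(s)} κ_π[a₁, …, a_s]`. -/
theorem moment_eq_sum_multExt_freeCumulant {𝒜 : Type*} [Ring 𝒜] [Algebra ℂ 𝒜] (φ : 𝒜 →ₗ[ℂ] ℂ)
    {s : ℕ} (hs : 0 < s) (a : Fin s → 𝒜) :
    φ (List.ofFn a).prod = ∑ π ∈ NC s, multExt (freeCumulant φ) π a := by
  classical
  have hne : (Finset.univ : Finset (Fin s)) ≠ ⊥ := by
    have : Nonempty (Fin s) := ⟨⟨0, hs⟩⟩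
    exact Finset.univ_nonempty.ne_empty
  set τ : Part s := Finpartition.indiscrete hne with hτ
  have hτp : τ.parts = {Finset.univ} := rfl
  have key : ∀ π : Part s, Finset.univ ∈ π.parts ↔ π = τ := by
    intro π
    constructor
    · intro h
      apply Finpartition.ext
      rw [hτp]
      apply Finset.eq_singleton_iff_unique_mem.mpr ⟨h, fun V hV => ?_⟩
      by_contra hVne
      have hd := π.disjoint (Finset.mem_coe.mpr hV) (Finset.mem_coe.mpr h) hVne
      have hd' : Disjoint V Finset.univ := hd
      exact π.ne_bot hV (disjoint_self.mp (hd'.mono_right (Finset.subset_univ V)))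
    · rintro rfl
      simp [hτp]
  have hτNC : τ ∈ NC s := by
    simp only [NC, Finset.mem_filter, Finset.mem_univ, true_and, IsNoncrossing, hτp,
      Finset.mem_singleton]
    rintro V rfl W rfl
    intros
    rfl
  have hcast : ∀ (m : ℕ) (V : Finset (Fin s)) (h : V.card = m),
      freeCumulant φ V.card (fun t => a (V.orderEmbOfFin rfl t)) =
        freeCumulant φ m (fun t => a (V.orderEmbOfFin h t)) := by
    rintro m V rfl
    rfl
  have htop : multExt (freeCumulant φ) τ a = freeCumulant φ s a := by
    have hc : (Finset.univ : Finset (Fin s)).card = s := by simp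
    have hid : ∀ t, (Finset.univ : Finset (Fin s)).orderEmbOfFin hc t = t := by
      intro t
      have := Finset.orderEmbOfFin_unique hc (f := id) (fun _ => Finset.mem_univ _) strictMono_id
      exact (congrFun this t).symm
    rw [multExt, hτp, Finset.prod_singleton, hcast s _ hc]
    simp only [hid]
  rw [← Finset.add_sum_erase _ _ hτNC, htop, freeCumulant, sub_add_eq_add_sub, eq_sub_iff_add_eq]
  congr 1
  rw [← Finset.sum_subtype ((NC s).erase τ) (fun π => by
    rw [Finset.mem_erase, key, and_comm]) (fun π => ∏ V : {V : Finset (Fin s) // V ∈ π.parts},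
        freeCumulant φ V.1.card (fun t => a (V.1.orderEmbOfFin rfl t)))]
  refine Finset.sum_congr rfl fun π _ => ?_
  rw [multExt]
  exact Finset.prod_coe_sort π.parts
    (fun V => freeCumulant φ V.card (fun t => a (V.orderEmbOfFin rfl t)))

/-- A family of matrices `A l = (a_{ij}^{(l)})` is R-cyclic if
`κ_r(a_{i₁j₁}^{(l₁)}, …, a_{i_rj_r}^{(l_r)}) = 0` unless `j₁ = i₂, …, j_{r-1} = i_r` and
`j_r = i₁`. Here `finRotate r` is the cyclic successor on `{0, …, r - 1}`. -/
def IsRCyclic {𝒜 I : Type*} [Ring 𝒜] [Algebra ℂ 𝒜] (φ : 𝒜 →ₗ[ℂ] ℂ) {n : ℕ}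
    (A : I → Matrix (Fin n) (Fin n) 𝒜) : Prop :=
  ∀ (r : ℕ) (l : Fin r → I) (i j : Fin r → Fin n),
    ¬ (∀ t, j t = i (finRotate r t)) → freeCumulant φ r (fun t => A (l t) (i t) (j t)) = 0

/-- The cumulants `κ_r(a_{i₁i₂}^{(l₁)}, a_{i₂i₃}^{(l₂)}, …, a_{i_ri₁}^{(l_r)})` with cyclic indices
do not depend on the indices `i₁, …, i_r`. -/
def CyclicCumulantsIndexFree {𝒜 I : Type*} [Ring 𝒜] [Algebra ℂ 𝒜] (φ : 𝒜 →ₗ[ℂ] ℂ) {n : ℕ}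
    (A : I → Matrix (Fin n) (Fin n) 𝒜) : Prop :=
  ∀ (r : ℕ) (l : Fin r → I) (i i' : Fin r → Fin n),
    freeCumulant φ r (fun t => A (l t) (i t) (i (finRotate r t))) =
      freeCumulant φ r (fun t => A (l t) (i' t) (i' (finRotate r t)))

/-- The common value `κ_r(a^{(l₁)}, …, a^{(l_r)})` of the cumulants with cyclic indices, read off at
`i₁ = ⋯ = i_r = 0`. -/
noncomputable def commonCumulant {𝒜 I : Type*} [Ring 𝒜] [Algebra ℂ 𝒜] (φ : 𝒜 →ₗ[ℂ] ℂ) {n : ℕ}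
    [NeZero n] (A : I → Matrix (Fin n) (Fin n) 𝒜) (r : ℕ) (l : Fin r → I) : ℂ :=
  freeCumulant φ r (fun t => A (l t) 0 0)

/-- For `p = (p₁, …, p_s)`, the index of the interval among the `s` consecutive intervals of lengths
`p₁, …, p_s` in `{0, …, p₁ + ⋯ + p_s - 1}` that contains the given element. -/
def intervalIndex {s : ℕ} (p : Fin s → ℕ) (v : Fin (∑ k, p k)) : Fin s :=
  (finSigmaFinEquiv.symm v).1

/-- The partition `γ_p` into consecutive intervals of lengths `p₁, …, p_s`, as an equivalence
relation. -/
def intervalSetoid {s : ℕ} (p : Fin s → ℕ) : Setoid (Fin (∑ k, p k)) :=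
  Setoid.ker (intervalIndex p)

/-- A partition as the equivalence relation of lying in the same block. -/
def Part.toSetoid {s : ℕ} (π : Part s) : Setoid (Fin s) :=
  Setoid.ker π.part

open Classical in
/-- The noncrossing partitions `π` of `{0, …, p₁ + ⋯ + p_s - 1}` whose join with the interval
partition `γ_p` is the one-block partition. -/
noncomputable def NCJoinTop {s : ℕ} (p : Fin s → ℕ) : Finset (Part (∑ k, p k)) :=
  (NC (∑ k, p k)).filter fun π => Part.toSetoid π ⊔ intervalSetoid p = ⊤

end FreeProb

/-!
Both sides of the formula are sequences of functions of `s` arguments (pairs of a letter and an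
exponent), and such a sequence is determined by the sums of its multiplicative extensions over
`NC(s)` (`eq_of_sum_multExt_eq`). So it suffices to show that the right-hand sides
(`connectedSum`) satisfy the moment-cumulant formula for the traces.

Write `p = p₁ + ⋯ + p_s`, let `γ` be the permutation rotating each of the `s` consecutive intervals,
and let a partition `π` also denote the permutation rotating each of its blocks. Expanding the
traces into entries and applying the moment-cumulant formula to the entries, R-cyclicity leaves for
each `π ∈ NC(p)` exactly the index tuples `i` with `i ∘ γ = i ∘ π`. They are the functions on the
cycles of `π⁻¹γ`, so `φ(χ(A_{l₁}^{p₁}) ⋯ χ(A_{l_s}^{p_s}))` equals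
`∑_{π ∈ NC(p)} n ^ #(π⁻¹γ) κ_π` (`moment_trace_pow`).

The number of cycles is given by Euler's formula `#γ + #π + #(π⁻¹γ) = p + 2 #(γ ∨ π)`
(`euler_formula`). Cutting a cycle of `γ` in two does not decrease
the quantity `#γ + #π + #(π⁻¹γ) - 2 #(γ ∨ π)` (`euler_mul_swap_le`). Its value at `γ = 1` is `p`,
whence `≤` for every `γ`. At the full cycle it is at least `p` by the Kreweras bound
(`card_add_one_le_kreweras`), and interval permutations arise from the full cycle by cutting, whence
`≥`.

Finally, grouping the `π ∈ NC(p)` by the partition `σ` that `π ∨ γ` induces on the `s` intervals,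
`σ` is noncrossing (`isNoncrossing_indexPart`), and `π` amounts to an independent choice, over each
block of `σ`, of a noncrossing partition whose join with the intervals is trivial
(`sum_filter_indexPart`). By Euler's formula the power of `n` is multiplicative over the blocks of
`σ`, and the sum becomes the moment-cumulant formula for `connectedSum`
(`sum_NC_eq_sum_multExt_connectedSum`).
-/

open scoped BigOperators

namespace FreeProb

open Equiv Equiv.Perm

/-! ### Equivalence classes and cycles -/

/-- The number of equivalence classes of an equivalence relation. -/
noncomputable def numClasses {α : Type*} (r : Setoid α) : ℕ := Nat.card (Quotient r)

/-- The number of cycles of a permutation, fixed points included. -/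
noncomputable def numCycles {α : Type*} (σ : Perm α) : ℕ := numClasses (SameCycle.setoid σ)

theorem numCycles_inv {α : Type*} (σ : Perm α) : numCycles σ⁻¹ = numCycles σ := by
  have : SameCycle.setoid σ⁻¹ = SameCycle.setoid σ := Setoid.ext fun _ _ => sameCycle_inv
  rw [numCycles, this, numCycles]

theorem numCycles_one {α : Type*} : numCycles (1 : Perm α) = Nat.card α := by
  refine (Nat.card_congr (Equiv.ofBijective (Quotient.mk _)
    ⟨fun a b hab => ?_, Quotient.mk_surjective⟩)).symm
  have : SameCycle (1 : Perm α) a b := Quotient.exact hab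
  simpa using this

section Classes

variable {α : Type*} [Finite α]

theorem numClasses_le_of_le {r t : Setoid α} (h : r ≤ t) : numClasses t ≤ numClasses r :=
  Nat.card_le_card_of_surjective (Quotient.map' id fun _ _ hab => h hab) fun q =>
    Quotient.inductionOn q fun a => ⟨Quotient.mk r a, rfl⟩

theorem numClasses_lt_of_le {r t : Setoid α} (h : r ≤ t) {x z : α} (ht : t x z) (hr : ¬ r x z) :
    numClasses t < numClasses r := by
  refine lt_of_le_of_ne (numClasses_le_of_le h) fun heq => hr ?_
  have hs : Function.Surjective (Quotient.map' id fun _ _ hab => h hab : Quotient r → Quotient t) :=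
    fun q => Quotient.inductionOn q fun a => ⟨Quotient.mk r a, rfl⟩
  have hb := (Nat.bijective_iff_surjective_and_card _).2 ⟨hs, heq.symm⟩
  have : Quotient.mk r x = Quotient.mk r z := hb.1 (Quotient.sound ht)
  exact Quotient.exact this

open Classical in
/-- Making two points equivalent lowers the number of classes by at most one. -/
theorem exists_merge (r : Setoid α) (x z : α) :
    ∃ u : Setoid α, r ≤ u ∧ u x z ∧ numClasses r ≤ numClasses u + 1 := by
  let f : α → Quotient r := fun v =>
    if Quotient.mk r v = Quotient.mk r z then Quotient.mk r x else Quotient.mk r v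
  refine ⟨Setoid.ker f, ?_, ?_, ?_⟩
  · intro a b hab
    have : Quotient.mk r a = Quotient.mk r b := Quotient.sound hab
    simp only [Setoid.ker_def, f, this]
  · simp only [Setoid.ker_def, f]
    split_ifs <;> rfl
  · -- every class of `r` but that of `z` is a value of `f`
    have hcard : numClasses (Setoid.ker f) = (Set.range f).ncard := by
      rw [numClasses, Nat.card_congr (Setoid.quotientKerEquivRange f), Set.ncard,
        Set.encard, ENat.card_eq_coe_natCard, ENat.toNat_natCast]
    have huniv : (Set.univ : Set (Quotient r)) ⊆ insert (Quotient.mk r z) (Set.range f) := by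
      intro q _
      induction q using Quotient.inductionOn with
      | h a =>
        by_cases ha : Quotient.mk r a = Quotient.mk r z
        · exact Or.inl ha
        · exact Or.inr ⟨a, by simp [f, ha]⟩
    rw [hcard, numClasses, ← Set.ncard_univ]
    exact (Set.ncard_le_ncard huniv).trans (Set.ncard_insert_le _ _)

theorem cycleSetoid_le_iff {σ : Perm α} {t : Setoid α} :
    SameCycle.setoid σ ≤ t ↔ ∀ v, t v (σ v) := by
  refine ⟨fun h v => h (⟨1, by simp⟩ : SameCycle σ v (σ v)), fun h a b hab => ?_⟩
  obtain ⟨k, rfl⟩ := SameCycle.exists_nat_pow_eq (f := σ) (x := a) (y := b) hab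
  clear hab
  induction k with
  | zero => exact t.refl _
  | succ k ih =>
    rw [pow_succ', mul_apply]
    exact t.trans ih (h _)

theorem cycleSetoid_mul_swap_le [DecidableEq α] {σ : Perm α} {t : Setoid α} {x z : α}
    (h : SameCycle.setoid σ ≤ t) (ht : t x z) : SameCycle.setoid (σ * swap x z) ≤ t := by
  rw [cycleSetoid_le_iff] at h ⊢
  intro v
  rw [mul_apply]
  rcases eq_or_ne v x with rfl | hx
  · rw [swap_apply_left]
    exact t.trans ht (h _)
  · rcases eq_or_ne v z with rfl | hz
    · rw [swap_apply_right]
      exact t.trans (t.symm ht) (h _)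
    · rw [swap_apply_of_ne_of_ne hx hz]
      exact h _

/-- If two cycles are joined by a transposition, then any two of their points become equivalent. -/
theorem sameCycle_mul_swap [DecidableEq α] {σ : Perm α} {x z : α} (h : ¬ SameCycle σ x z) :
    SameCycle (σ * swap x z) x z := by
  set ρ := σ * swap x z
  have key : ∀ k : ℕ, SameCycle ρ z x ∨ SameCycle ρ z ((σ ^ (k + 1)) x) := by
    intro k
    induction k with
    | zero =>
      right
      refine ⟨1, ?_⟩
      simp [ρ]
    | succ k ih =>
      rcases ih with ih | ih
      · exact Or.inl ih
      · by_cases hw : (σ ^ (k + 1)) x = x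
        · rw [hw] at ih
          exact Or.inl ih
        · right
          have hwz : (σ ^ (k + 1)) x ≠ z := fun e => h ⟨(k + 1 : ℕ), by rw [zpow_natCast, e]⟩
          have hstep : ρ ((σ ^ (k + 1)) x) = (σ ^ (k + 1 + 1)) x := by
            rw [pow_succ' σ (k + 1), mul_apply, mul_apply, swap_apply_of_ne_of_ne hw hwz]
          rw [← hstep]
          exact sameCycle_apply_right.2 ih
  have hpos := orderOf_pos σ
  rcases key (orderOf σ - 1) with h | h
  · exact h.symm
  · rw [Nat.sub_add_cancel hpos, pow_orderOf_eq_one] at h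
    exact h.symm

theorem numCycles_mul_swap_lt [DecidableEq α] {σ : Perm α} {x z : α} (h : ¬ SameCycle σ x z) :
    numCycles (σ * swap x z) < numCycles σ := by
  refine numClasses_lt_of_le ?_ (sameCycle_mul_swap h) h
  have := cycleSetoid_mul_swap_le (σ := σ * swap x z) (x := x) (z := z) le_rfl
    (sameCycle_mul_swap h)
  rwa [mul_assoc, swap_mul_self, mul_one] at this

theorem numCycles_mul_swap_le [DecidableEq α] (σ : Perm α) (x z : α) :
    numCycles (σ * swap x z) ≤ numCycles σ + 1 := by
  obtain ⟨u, hu, hxz, hc⟩ := exists_merge (SameCycle.setoid (σ * swap x z)) x z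
  refine hc.trans (Nat.add_le_add_right (numClasses_le_of_le ?_) 1)
  have := cycleSetoid_mul_swap_le hu hxz
  rwa [mul_assoc, swap_mul_self, mul_one] at this

/-- The number of classes of the equivalence relation generated by two permutations. -/
noncomputable def numJoin (γ π : Perm α) : ℕ :=
  numClasses (SameCycle.setoid γ ⊔ SameCycle.setoid π)

/-- The Euler characteristic `#γ + #π + #(π⁻¹γ) - 2 #(γ ∨ π)` does not decrease when a cycle
of `γ` is cut into two. -/
theorem euler_mul_swap_le [DecidableEq α] {γ : Perm α} (π : Perm α) {x z : α}
    (h : ¬ SameCycle γ x z) :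
    numCycles (γ * swap x z) + numCycles (π⁻¹ * (γ * swap x z)) + 2 * numJoin γ π ≤
      numCycles γ + numCycles (π⁻¹ * γ) + 2 * numJoin (γ * swap x z) π := by
  have h1 := numCycles_mul_swap_lt h
  have hle : ∀ u, SameCycle.setoid γ ⊔ SameCycle.setoid π ≤ u → u x z →
      SameCycle.setoid (γ * swap x z) ⊔ SameCycle.setoid π ≤ u := fun u hu hxz =>
    sup_le (cycleSetoid_mul_swap_le (le_sup_left.trans hu) hxz) (le_sup_right.trans hu)
  rw [← mul_assoc]
  by_cases hj : (SameCycle.setoid γ ⊔ SameCycle.setoid π) x z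
  · have h2 : numJoin γ π ≤ numJoin (γ * swap x z) π := numClasses_le_of_le (hle _ le_rfl hj)
    have h3 := numCycles_mul_swap_le (π⁻¹ * γ) x z
    omega
  · obtain ⟨u, hu, hxz, hc⟩ := exists_merge (SameCycle.setoid γ ⊔ SameCycle.setoid π) x z
    have h2 : numClasses u ≤ numJoin (γ * swap x z) π := numClasses_le_of_le (hle _ hu hxz)
    have hρ : SameCycle.setoid (π⁻¹ * γ) ≤ SameCycle.setoid γ ⊔ SameCycle.setoid π := by
      rw [cycleSetoid_le_iff]
      intro v
      have e1 : (SameCycle.setoid γ ⊔ SameCycle.setoid π) v (γ v) :=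
        (le_sup_left : SameCycle.setoid γ ≤ _) (⟨1, by simp⟩ : SameCycle γ v (γ v))
      have e2 : (SameCycle.setoid γ ⊔ SameCycle.setoid π) (γ v) (π⁻¹ (γ v)) :=
        (le_sup_right : SameCycle.setoid π ≤ _) (⟨-1, by simp⟩ : SameCycle π (γ v) (π⁻¹ (γ v)))
      exact Setoid.trans' _ e1 e2
    have h3 := numCycles_mul_swap_lt (σ := π⁻¹ * γ) (x := x) (z := z) fun hs => hj (hρ hs)
    have : numJoin γ π ≤ numClasses u + 1 := hc
    omega

end Classes

theorem numCycles_le_euler {α : Type*} [Fintype α] [DecidableEq α] (γ π : Perm α) :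
    numCycles γ + numCycles π + numCycles (π⁻¹ * γ) ≤ Fintype.card α + 2 * numJoin γ π := by
  induction hn : γ.support.card using Nat.strong_induction_on generalizing γ with
  | _ n ih =>
    by_cases hγ : γ = 1
    · subst hγ
      have hbot : SameCycle.setoid (1 : Perm α) ≤ SameCycle.setoid π := by
        rw [cycleSetoid_le_iff]
        exact fun v => Setoid.refl' _ v
      have hj : numJoin 1 π = numCycles π := by rw [numJoin, sup_eq_right.2 hbot, numCycles]
      rw [hj, mul_one, numCycles_inv, numCycles_one, Nat.card_eq_fintype_card]
      omega
    · obtain ⟨w, hw⟩ : ∃ w, γ w ≠ w := not_forall.1 fun h => hγ (Equiv.ext h)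
      set z := γ w with hz
      have hzz : γ z ≠ z := fun e => hw (γ.injective e)
      -- `z` is a fixed point of the cut permutation
      have heq : γ * swap w z = swap z (γ z) * γ := by rw [mul_swap_eq_swap_mul, ← hz]
      have hlt : (γ * swap w z).support.card < n := by
        rw [← hn, heq]
        exact card_support_swap_mul hzz
      have hfix : (γ * swap w z) z = z := by simp [← hz]
      have hns : ¬ SameCycle (γ * swap w z) w z := fun hs =>
        hw (hs.symm.eq_of_left hfix)
      have h1 := euler_mul_swap_le π hns
      rw [mul_assoc, swap_mul_self, mul_one] at h1
      have h2 := ih _ hlt (γ * swap w z) rfl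
      omega

/-! ### Noncrossing permutations and Euler's formula -/

/-- A permutation of an ordered set is noncrossing if, whenever `x < π x`, it maps the interval
`[x, π x)` onto `(x, π x]`. -/
def IsNoncrossingPerm {α : Type*} [LinearOrder α] (π : Perm α) : Prop :=
  ∀ x, x < π x → ∀ v, (x < π v ∧ π v ≤ π x) ↔ (x ≤ v ∧ v < π x)

theorem IsNoncrossingPerm.mul_swap {α : Type*} [LinearOrder α] {π : Perm α}
    (h : IsNoncrossingPerm π) {x : α} (hx : x < π x) : IsNoncrossingPerm (π * swap x (π x)) := by
  set m := π x with hm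
  have e1 : (π * swap x m) x = π m := by simp
  have e2 : (π * swap x m) m = m := by simp [← hm]
  have e3 : ∀ u, u ≠ x → u ≠ m → (π * swap x m) u = π u := fun u h1 h2 => by
    rw [mul_apply, swap_apply_of_ne_of_ne h1 h2]
  have hxm := h x hx
  rw [← hm] at hxm
  have hinj : ∀ u, u ≠ x → π u ≠ m := fun u hu e => hu (π.injective (e.trans hm))
  intro v hv u
  rcases eq_or_ne v m with rfl | hvm
  · rw [e2] at hv
    exact absurd hv (lt_irrefl _)
  rcases eq_or_ne v x with rfl | hvx
  · rw [e1] at hv ⊢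
    have hmm := hxm m
    -- otherwise `π m` would lie in `(x, m]`
    have hlt : m < π m := by
      by_contra hcon
      exact absurd (hmm.1 ⟨hv, not_lt.1 hcon⟩).2 (lt_irrefl _)
    have hm' := h m hlt
    rcases eq_or_ne u v with rfl | hux
    · rw [e1]; simp [hv]
    · rcases eq_or_ne u m with rfl | hum
      · rw [e2]; simp [hx, hx.le, hlt, hlt.le]
      · rw [e3 u hux hum]
        have a1 := hxm u
        have a2 := hm' u
        have a3 := hinj u hux
        grind
  · rw [e3 v hvx hvm] at hv ⊢
    have hv' := h v hv
    have hpv := hinj v hvx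
    rcases eq_or_ne u x with rfl | hux
    · rw [e1]
      have a1 := hv' u
      have a2 := hv' m
      rw [← hm] at a1
      grind
    · rcases eq_or_ne u m with rfl | hum
      · rw [e2]; grind
      · rw [e3 u hux hum]; exact hv' u

theorem finRotate_val {p : ℕ} (v : Fin p) :
    (finRotate p v : ℕ) = if (v : ℕ) + 1 < p then (v : ℕ) + 1 else 0 := by
  obtain ⟨m, rfl⟩ := Nat.exists_eq_add_one.2 v.pos
  rw [coe_finRotate]
  have := v.2
  split_ifs with h1 h2 h2
  · subst h1; simp at h2
  · rfl
  · rfl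
  · exact absurd (Fin.ext (by simp; omega)) h1

theorem eq_one_of_forall_le {α : Type*} [LinearOrder α] [Finite α] {π : Perm α}
    (h : ∀ x, π x ≤ x) : π = 1 := by
  refine Equiv.ext fun x => ?_
  induction x using WellFoundedLT.induction with
  | _ x ih =>
    by_contra hne
    have hlt := lt_of_le_of_ne (h x) hne
    exact hne (π.injective (ih _ hlt))

theorem numClasses_top {α : Type*} [Nonempty α] : numClasses (⊤ : Setoid α) = 1 := by
  rw [numClasses, Nat.card_eq_one_iff_unique]
  exact ⟨⟨fun a b => Quotient.inductionOn₂ a b fun _ _ => Quotient.sound trivial⟩,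
    Nonempty.map (Quotient.mk _) inferInstance⟩

theorem cycleSetoid_finRotate (p : ℕ) : SameCycle.setoid (finRotate p) = ⊤ := by
  have h0 : ∀ (k : ℕ) (hk : k < p), SameCycle (finRotate p) ⟨0, by omega⟩ ⟨k, hk⟩ := by
    intro k
    induction k with
    | zero => exact fun _ => SameCycle.refl _ _
    | succ k ih =>
      intro hk
      have : (⟨k + 1, hk⟩ : Fin p) = finRotate p ⟨k, by omega⟩ :=
        Fin.ext (by rw [finRotate_val]; simp [hk])
      rw [this]
      exact sameCycle_apply_right.2 (ih _)
  refine Setoid.ext fun a b => ⟨fun _ => trivial, fun _ => ?_⟩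
  exact (h0 a a.2).symm.trans (h0 b b.2)

/-- A noncrossing permutation together with its Kreweras complement has at least `p + 1` cycles. -/
theorem card_add_one_le_kreweras {p : ℕ} (hp : 0 < p) {π : Perm (Fin p)}
    (h : IsNoncrossingPerm π) :
    p + 1 ≤ numCycles π + numCycles ((finRotate p)⁻¹ * π) := by
  have : Nonempty (Fin p) := ⟨⟨0, hp⟩⟩
  induction hn : π.support.card using Nat.strong_induction_on generalizing π with
  | _ n ih =>
    by_cases hex : ∃ x, x < π x
    · obtain ⟨x, hx⟩ := hex
      have hlt : (π * swap x (π x)).support.card < n := by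
        rw [← hn, mul_swap_eq_swap_mul]
        exact card_support_swap_mul fun e => hx.ne (π.injective e).symm
      have h1 := ih _ hlt (h.mul_swap hx) rfl
      have h2 := numCycles_mul_swap_le π x (π x)
      -- the indicator of `[x, π x)` is invariant under `c⁻¹ π`
      have hns : ¬ SameCycle ((finRotate p)⁻¹ * π) x (π x) := by
        intro hs
        let t : Setoid (Fin p) := Setoid.ker fun v => x ≤ v ∧ v < π x
        have ht : SameCycle.setoid ((finRotate p)⁻¹ * π) ≤ t := by
          rw [cycleSetoid_le_iff]
          intro v
          obtain ⟨w, hw⟩ := (finRotate p).surjective (π v)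
          have hwv : ((finRotate p)⁻¹ * π) v = w := by
            rw [mul_apply, ← hw, Perm.inv_def, Equiv.symm_apply_apply]
          rw [hwv]
          show (x ≤ v ∧ v < π x) = (x ≤ w ∧ w < π x)
          rw [← h x hx v, ← hw]
          have hval := finRotate_val w
          have := w.2
          have := (π x).2
          simp only [Fin.le_def, Fin.lt_def, hval, eq_iff_iff]
          split_ifs <;> omega
        have : (x ≤ x ∧ x < π x) = (x ≤ π x ∧ π x < π x) := ht hs
        simp [hx] at this
      have h3 := numCycles_mul_swap_lt hns
      rw [mul_assoc] at h3
      omega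
    · have : π = 1 := eq_one_of_forall_le fun x => not_lt.1 fun hx => hex ⟨x, hx⟩
      rw [this, mul_one, numCycles_one, numCycles_inv, numCycles, cycleSetoid_finRotate,
        numClasses_top, Nat.card_eq_fintype_card, Fintype.card_fin]

theorem euler_le_numCycles {p : ℕ} (hp : 0 < p) {γ π : Perm (Fin p)}
    (hγ : ∀ v, (γ v : ℕ) ≤ v + 1) (h : IsNoncrossingPerm π) :
    p + 2 * numJoin γ π ≤ numCycles γ + numCycles π + numCycles (π⁻¹ * γ) := by
  have : Nonempty (Fin p) := ⟨⟨0, hp⟩⟩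
  induction hn : (Finset.univ.filter fun v => (γ v : ℕ) ≠ v + 1).card
    using Nat.strong_induction_on generalizing γ with
  | _ n ih =>
    by_cases hex : ∃ z : Fin p, (z : ℕ) + 1 < p ∧ (γ z : ℕ) ≠ z + 1
    · obtain ⟨z, hz1, hz⟩ := hex
      obtain ⟨w, hw⟩ := γ.surjective ⟨z + 1, hz1⟩
      -- `γ` preserves `[0, z]`, so `γ⁻¹ (z + 1)` lies in another cycle than `z`
      have hwval : (γ w : ℕ) = z + 1 := by rw [hw]
      have hwz : z < w := by
        have := hγ w
        rcases lt_trichotomy w z with h1 | h1 | h1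
        · rw [Fin.lt_def] at h1; omega
        · subst h1; exact absurd hwval hz
        · exact h1
      have hns : ¬ SameCycle γ z w := by
        intro hs
        let t : Setoid (Fin p) := Setoid.ker fun v => v ≤ z
        have hmap : ∀ v, v ≤ z → γ v ≤ z := by
          intro v hv
          have h1 := hγ v
          rcases hv.lt_or_eq with h2 | h2
          · rw [Fin.lt_def] at h2; rw [Fin.le_def]; omega
          · subst h2; rw [Fin.le_def]; omega
        have hpow : ∀ k : ℕ, (γ ^ k) z ≤ z := by
          intro k
          induction k with
          | zero => simp
          | succ k ih => rw [pow_succ', mul_apply]; exact hmap _ ih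
        obtain ⟨k, hk⟩ := hs.exists_nat_pow_eq
        exact absurd (hk ▸ hpow k) (not_le.2 hwz)
      have e1 : (γ * swap z w) z = γ w := by simp
      have e2 : (γ * swap z w) w = γ z := by simp
      have e3 : ∀ u, u ≠ z → u ≠ w → (γ * swap z w) u = γ u := fun u h1 h2 => by
        rw [mul_apply, swap_apply_of_ne_of_ne h1 h2]
      have hγ' : ∀ v, ((γ * swap z w) v : ℕ) ≤ v + 1 := by
        intro v
        rcases eq_or_ne v z with rfl | hv
        · rw [e1, hwval]
        · rcases eq_or_ne v w with rfl | hv'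
          · have := hγ z
            rw [Fin.lt_def] at hwz
            rw [e2]; omega
          · rw [e3 v hv hv']; exact hγ v
      have hlt : (Finset.univ.filter fun v => ((γ * swap z w) v : ℕ) ≠ v + 1).card < n := by
        rw [← hn]
        refine Finset.card_lt_card (Finset.ssubset_iff_of_subset ?_ |>.2 ⟨z, ?_, ?_⟩)
        · intro v
          simp only [Finset.mem_filter, Finset.mem_univ, true_and]
          rcases eq_or_ne v z with rfl | hv
          · exact fun _ => hz
          · rcases eq_or_ne v w with rfl | hv'
            · rw [Fin.lt_def] at hwz
              intro _; omega
            · rw [e3 v hv hv']; exact id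
        · simpa using hz
        · simp only [Finset.mem_filter, Finset.mem_univ, true_and, e1, hwval]
          simp
      have h1 := ih _ hlt hγ' rfl
      have h2 := euler_mul_swap_le π hns
      omega
    · have hc : γ = finRotate p := by
        have hne : ∀ z : Fin p, (z : ℕ) + 1 < p → γ z = finRotate p z := by
          intro z hz
          refine Fin.ext ?_
          rw [finRotate_val, if_pos hz]
          by_contra hcon
          exact hex ⟨z, hz, hcon⟩
        refine Equiv.ext fun z => ?_
        by_cases hz : (z : ℕ) + 1 < p
        · exact hne z hz
        · obtain ⟨w, hw⟩ := γ.surjective (finRotate p z)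
          have hwz : w = z := by
            by_contra hcon
            have h1 : (w : ℕ) + 1 < p := by
              have := w.2
              have := z.2
              have : (w : ℕ) ≠ z := fun e => hcon (Fin.ext e)
              omega
            exact hcon ((finRotate p).injective ((hne w h1).symm.trans hw))
          rw [← hw, hwz]
      subst hc
      have hj : numJoin (finRotate p) π = 1 := by
        rw [numJoin, cycleSetoid_finRotate, top_sup_eq, numClasses_top]
      have h1 : numCycles (finRotate p) = 1 := by
        rw [numCycles, cycleSetoid_finRotate, numClasses_top]
      have h2 := card_add_one_le_kreweras hp h
      rw [← numCycles_inv (_ * π), mul_inv_rev, inv_inv] at h2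
      omega

/-- For a noncrossing permutation `π` and a permutation `γ` whose cycles are consecutive
intervals, Euler's formula `#γ + #π + #(π⁻¹γ) = p + 2 #(γ ∨ π)` holds: the genus is zero. -/
theorem euler_formula {p : ℕ} (hp : 0 < p) {γ π : Perm (Fin p)}
    (hγ : ∀ v, (γ v : ℕ) ≤ v + 1) (h : IsNoncrossingPerm π) :
    numCycles γ + numCycles π + numCycles (π⁻¹ * γ) = p + 2 * numJoin γ π :=
  le_antisymm (by simpa using numCycles_le_euler γ π) (euler_le_numCycles hp hγ h)

/-! ### Permutations that rotate the blocks of a partition -/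

/-- Given an enumeration of `α` by blocks `Fin (m i)`, the permutation of `α` that rotates each
block cyclically. -/
def sigmaRotate {ι α : Type*} {m : ι → ℕ} (e : (Σ i, Fin (m i)) ≃ α) : Perm α :=
  e.permCongr (Equiv.sigmaCongrRight fun i => finRotate (m i))

section SigmaRotate

variable {ι α : Type*} {m : ι → ℕ} (e : (Σ i, Fin (m i)) ≃ α)

theorem sigmaRotate_apply (i : ι) (t : Fin (m i)) :
    sigmaRotate e (e ⟨i, t⟩) = e ⟨i, finRotate (m i) t⟩ := by
  simp [sigmaRotate]

theorem cycleSetoid_sigmaRotate [Finite α] :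
    SameCycle.setoid (sigmaRotate e) = Setoid.ker fun v => (e.symm v).1 := by
  apply le_antisymm
  · rw [cycleSetoid_le_iff]
    intro v
    obtain ⟨⟨i, t⟩, rfl⟩ := e.surjective v
    rw [sigmaRotate_apply, Setoid.ker_def]
    simp
  · intro v w h
    obtain ⟨⟨i, t⟩, rfl⟩ := e.surjective v
    obtain ⟨⟨j, u⟩, rfl⟩ := e.surjective w
    rw [Setoid.ker_def] at h
    simp only [symm_apply_apply] at h
    subst h
    have hle : SameCycle.setoid (finRotate (m i)) ≤
        (SameCycle.setoid (sigmaRotate e)).comap fun t => e ⟨i, t⟩ := by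
      rw [cycleSetoid_le_iff]
      intro v
      rw [Setoid.comap_rel, ← sigmaRotate_apply]
      exact ⟨1, by simp⟩
    rw [cycleSetoid_finRotate] at hle
    exact hle trivial

theorem numCycles_sigmaRotate [Finite α] (hm : ∀ i, 0 < m i) :
    numCycles (sigmaRotate e) = Nat.card ι := by
  rw [numCycles, cycleSetoid_sigmaRotate, numClasses]
  refine Nat.card_congr (Setoid.quotientKerEquivOfSurjective _ fun i => ?_)
  exact ⟨e ⟨i, ⟨0, hm i⟩⟩, by simp⟩

end SigmaRotate

/-- The enumeration of `{0, …, p - 1}` by the blocks of a partition, each in increasing order. -/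
noncomputable def blockEquiv {p : ℕ} (π : Part p) : (Σ V : π.parts, Fin V.1.card) ≃ Fin p :=
  Equiv.ofBijective (fun x => x.1.1.orderEmbOfFin rfl x.2) <| by
    constructor
    · rintro ⟨⟨V, hV⟩, t⟩ ⟨⟨W, hW⟩, u⟩ h
      have h' : V.orderEmbOfFin rfl t = W.orderEmbOfFin rfl u := h
      have : V = W := π.eq_of_mem_parts hV hW (V.orderEmbOfFin_mem rfl t)
        (h' ▸ W.orderEmbOfFin_mem rfl u)
      subst this
      rw [(V.orderEmbOfFin rfl).injective h']
    · intro v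
      have hv : v ∈ π.part v := π.mem_part_self.2 (Finset.mem_univ v)
      have hr : v ∈ Set.range ((π.part v).orderEmbOfFin rfl) := by
        rw [Finset.range_orderEmbOfFin]; exact hv
      obtain ⟨t, ht⟩ := hr
      exact ⟨⟨⟨π.part v, π.part_mem.2 (Finset.mem_univ v)⟩, t⟩, ht⟩

/-- The permutation whose cycles are the blocks of a partition, each rotated in increasing
order. -/
noncomputable def blockPerm {p : ℕ} (π : Part p) : Perm (Fin p) := sigmaRotate (blockEquiv π)

theorem blockPerm_apply {p : ℕ} (π : Part p) {V : Finset (Fin p)} (hV : V ∈ π.parts)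
    (t : Fin V.card) :
    blockPerm π (V.orderEmbOfFin rfl t) = V.orderEmbOfFin rfl (finRotate V.card t) :=
  sigmaRotate_apply (blockEquiv π) ⟨V, hV⟩ t

theorem exists_eq_orderEmbOfFin {p : ℕ} (π : Part p) (v : Fin p) :
    ∃ V ∈ π.parts, ∃ t : Fin V.card, v = V.orderEmbOfFin rfl t := by
  obtain ⟨⟨⟨V, hV⟩, t⟩, rfl⟩ := (blockEquiv π).surjective v
  exact ⟨V, hV, t, rfl⟩

theorem cycleSetoid_blockPerm {p : ℕ} (π : Part p) :
    SameCycle.setoid (blockPerm π) = Part.toSetoid π := by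
  rw [blockPerm, cycleSetoid_sigmaRotate]
  have : (fun v => ((blockEquiv π).symm v).1.1) = π.part := by
    funext v
    obtain ⟨⟨⟨V, hV⟩, t⟩, rfl⟩ := (blockEquiv π).surjective v
    rw [symm_apply_apply]
    exact (π.part_eq_of_mem hV (V.orderEmbOfFin_mem rfl t)).symm
  refine Setoid.ext fun v w => ?_
  rw [Part.toSetoid, ← this, Setoid.ker_def, Setoid.ker_def, Subtype.ext_iff]

theorem numCycles_blockPerm {p : ℕ} (π : Part p) : numCycles (blockPerm π) = π.parts.card := by
  rw [blockPerm, numCycles_sigmaRotate, Nat.card_eq_fintype_card, Fintype.card_coe]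
  exact fun V => Finset.card_pos.2 (π.nonempty_of_mem_parts V.2)

theorem IsNoncrossing.blockPerm {p : ℕ} {π : Part p} (h : IsNoncrossing π) :
    IsNoncrossingPerm (blockPerm π) := by
  intro x hx v
  obtain ⟨V, hV, t, rfl⟩ := exists_eq_orderEmbOfFin π x
  obtain ⟨W, hW, u, rfl⟩ := exists_eq_orderEmbOfFin π v
  rw [blockPerm_apply π hV] at hx ⊢
  rw [blockPerm_apply π hW]
  by_cases hVW : V = W
  · subst hVW
    simp only [OrderEmbedding.lt_iff_lt, OrderEmbedding.le_iff_le, Fin.lt_def, Fin.le_def,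
      finRotate_val] at hx ⊢
    have := t.2
    have := u.2
    split_ifs at hx ⊢ <;> omega
  · -- a block other than `V` lies either inside or outside a gap of `V`
    have key : ∀ a b, a ∈ W → b ∈ W → V.orderEmbOfFin rfl t < a →
        a < V.orderEmbOfFin rfl (finRotate V.card t) → V.orderEmbOfFin rfl t < b ∧
        b < V.orderEmbOfFin rfl (finRotate V.card t) := by
      intro a b ha hb h1 h2
      have hxV := V.orderEmbOfFin_mem rfl t
      have hyV := V.orderEmbOfFin_mem rfl (finRotate V.card t)
      have hbx : b ≠ V.orderEmbOfFin rfl t := fun e =>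
        hVW (π.eq_of_mem_parts hV hW hxV (e ▸ hb))
      have hby : b ≠ V.orderEmbOfFin rfl (finRotate V.card t) := fun e =>
        hVW (π.eq_of_mem_parts hV hW hyV (e ▸ hb))
      constructor
      · by_contra hcon
        exact hVW (h W hW V hV b _ a _ (lt_of_le_of_ne (not_lt.1 hcon) hbx) h1 h2 hb ha
          hxV hyV).symm
      · by_contra hcon
        exact hVW (h V hV W hW _ a _ b h1 h2 (lt_of_le_of_ne (not_lt.1 hcon) hby.symm) hxV hyV
          ha hb)
    have hne : ∀ (s : Fin V.card) (r : Fin W.card),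
        V.orderEmbOfFin rfl s ≠ W.orderEmbOfFin rfl r := fun s r e =>
      hVW (π.eq_of_mem_parts hV hW (V.orderEmbOfFin_mem rfl s)
        (e ▸ W.orderEmbOfFin_mem rfl r))
    constructor
    · rintro ⟨h1, h2⟩
      have := key _ _ (W.orderEmbOfFin_mem rfl (finRotate W.card u)) (W.orderEmbOfFin_mem rfl u) h1
        (lt_of_le_of_ne h2 (hne _ _).symm)
      exact ⟨this.1.le, this.2⟩
    · rintro ⟨h1, h2⟩
      have := key _ _ (W.orderEmbOfFin_mem rfl u) (W.orderEmbOfFin_mem rfl (finRotate W.card u))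
        (lt_of_le_of_ne h1 (hne _ _)) h2
      exact ⟨this.1, this.2.le⟩

/-! ### Consecutive intervals -/

theorem finSigmaFinEquiv_lt {s : ℕ} {p : Fin s → ℕ} {k k' : Fin s} (h : k < k') (t : Fin (p k))
    (t' : Fin (p k')) :
    (finSigmaFinEquiv ⟨k, t⟩ : Fin (∑ k, p k)) < finSigmaFinEquiv ⟨k', t'⟩ := by
  have hsum : ∀ k : Fin s, ∑ i : Fin k.1, p (Fin.castLE k.2.le i) = ∑ i ∈ Finset.Iio k, p i := by
    intro k
    refine Finset.sum_bij' (fun i _ => Fin.castLE k.2.le i)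
      (fun i hi => ⟨i.1, Fin.lt_def.1 (Finset.mem_Iio.1 hi)⟩) ?_ ?_ ?_ ?_ ?_
    · intro i _; exact Finset.mem_Iio.2 i.2
    all_goals intros; first | rfl | exact Finset.mem_univ _
  rw [Fin.lt_def, finSigmaFinEquiv_apply, finSigmaFinEquiv_apply, hsum, hsum]
  have h1 : ∑ i ∈ Finset.Iio k, p i + p k ≤ ∑ i ∈ Finset.Iio k', p i := by
    rw [add_comm, ← Finset.sum_insert (by simp)]
    refine Finset.sum_le_sum_of_subset fun i hi => ?_
    rcases Finset.mem_insert.1 hi with rfl | hi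
    · exact Finset.mem_Iio.2 h
    · exact Finset.mem_Iio.2 ((Finset.mem_Iio.1 hi).trans h)
  have := t.2
  simp only
  omega

theorem finSigmaFinEquiv_lt_iff {s : ℕ} {p : Fin s → ℕ} {k : Fin s} {t t' : Fin (p k)} :
    (finSigmaFinEquiv ⟨k, t⟩ : Fin (∑ k, p k)) < finSigmaFinEquiv ⟨k, t'⟩ ↔ t < t' := by
  rw [Fin.lt_def, finSigmaFinEquiv_apply, finSigmaFinEquiv_apply, Fin.lt_def]
  exact Nat.add_lt_add_iff_left

theorem intervalIndex_apply {s : ℕ} (p : Fin s → ℕ) (k : Fin s) (t : Fin (p k)) :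
    intervalIndex p (finSigmaFinEquiv ⟨k, t⟩) = k := by
  simp [intervalIndex]

theorem intervalIndex_monotone {s : ℕ} (p : Fin s → ℕ) : Monotone (intervalIndex p) := by
  intro v w h
  obtain ⟨⟨k, t⟩, rfl⟩ := finSigmaFinEquiv.surjective v
  obtain ⟨⟨k', t'⟩, rfl⟩ := finSigmaFinEquiv.surjective w
  rw [intervalIndex_apply, intervalIndex_apply]
  by_contra hcon
  exact absurd h (not_le.2 (finSigmaFinEquiv_lt (not_le.1 hcon) t' t))

/-- The permutation whose cycles are the consecutive intervals of lengths `p₁, …, p_s`. -/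
def intervalPerm {s : ℕ} (p : Fin s → ℕ) : Perm (Fin (∑ k, p k)) := sigmaRotate finSigmaFinEquiv

theorem intervalPerm_le {s : ℕ} (p : Fin s → ℕ) (v : Fin (∑ k, p k)) :
    (intervalPerm p v : ℕ) ≤ v + 1 := by
  obtain ⟨⟨k, t⟩, rfl⟩ := finSigmaFinEquiv.surjective v
  rw [intervalPerm, sigmaRotate_apply, finSigmaFinEquiv_apply, finSigmaFinEquiv_apply,
    finRotate_val]
  simp only
  split_ifs <;> omega

theorem cycleSetoid_intervalPerm {s : ℕ} (p : Fin s → ℕ) :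
    SameCycle.setoid (intervalPerm p) = intervalSetoid p :=
  cycleSetoid_sigmaRotate _

theorem numCycles_intervalPerm {s : ℕ} {p : Fin s → ℕ} (hp : ∀ k, 1 ≤ p k) :
    numCycles (intervalPerm p) = s := by
  rw [intervalPerm, numCycles_sigmaRotate _ hp, Nat.card_eq_fintype_card, Fintype.card_fin]

/-! ### Counting index tuples -/

/-- The number of cycles of `π⁻¹γ` for a noncrossing partition `π` and the interval partition
`γ`. -/
theorem numCycles_blockPerm_inv_mul {s : ℕ} (hs : 1 ≤ s) {p : Fin s → ℕ} (hp : ∀ k, 1 ≤ p k)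
    {π : Part (∑ k, p k)} (h : IsNoncrossing π) :
    s + π.parts.card + numCycles ((blockPerm π)⁻¹ * intervalPerm p) =
      ∑ k, p k + 2 * numClasses (Part.toSetoid π ⊔ intervalSetoid p) := by
  have hpos : 0 < ∑ k, p k :=
    (hp ⟨0, hs⟩).trans (Finset.single_le_sum (fun _ _ => Nat.zero_le _) (Finset.mem_univ _))
  have := euler_formula hpos (intervalPerm_le p) h.blockPerm
  rwa [numCycles_intervalPerm hp, numCycles_blockPerm, numJoin, cycleSetoid_blockPerm,
    cycleSetoid_intervalPerm, sup_comm] at this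

/-- Index tuples `i` with `i ∘ γ = i ∘ π` are the functions on the cycles of `π⁻¹γ`. -/
theorem card_filter_comp_eq {α : Type*} [Fintype α] [DecidableEq α] (γ π : Perm α) (n : ℕ) :
    (Finset.univ.filter fun i : α → Fin n => ∀ v, i (γ v) = i (π v)).card =
      n ^ numCycles (π⁻¹ * γ) := by
  have e : {i : α → Fin n // ∀ v, i (γ v) = i (π v)} ≃
      (Quotient (SameCycle.setoid (π⁻¹ * γ)) → Fin n) :=
    { toFun := fun i q => Quotient.liftOn q (fun v => i.1 (π v)) (by
        have hle : SameCycle.setoid (π⁻¹ * γ) ≤ Setoid.ker fun v => i.1 (π v) := by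
          rw [cycleSetoid_le_iff]
          intro v
          rw [Setoid.ker_def, mul_apply, Perm.inv_def, Equiv.apply_symm_apply]
          exact (i.2 v).symm
        exact fun a b hab => hle hab)
      invFun := fun f => ⟨fun v => f (Quotient.mk _ (π⁻¹ v)), fun v => by
        refine congrArg f (Quotient.sound ?_)
        have : SameCycle (π⁻¹ * γ) v ((π⁻¹ * γ) v) := ⟨1, by simp⟩
        rw [← mul_apply, Perm.inv_def π, Equiv.symm_apply_apply]
        exact this.symm⟩
      left_inv := fun i => by
        refine Subtype.ext (funext fun v => congrArg i.1 ?_)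
        exact π.apply_symm_apply v
      right_inv := fun f => by
        funext q
        induction q using Quotient.inductionOn with
        | h v => simp [Perm.inv_def] }
  classical
  rw [← Fintype.card_subtype, Fintype.card_eq_nat_card, Nat.card_congr e, Nat.card_fun,
    Nat.card_eq_fintype_card (α := Fin n), Fintype.card_fin]
  rfl

/-! ### Moments of traces of powers -/

section Expansion

variable {R : Type*} [Ring R]

/-- An entry of a power as a sum over paths `a, i₀, …, i_{m-1}, b`: step `t` leads from the `t`-th
entry of `a, i₀, …` to the `t`-th entry of `i₀, …, i_{m-1}, b`. -/
theorem pow_apply_eq_sum {n : ℕ} (A : Matrix (Fin n) (Fin n) R) (m : ℕ) (a b : Fin n) :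
    (A ^ (m + 1)) a b = ∑ i : Fin m → Fin n, (List.ofFn fun t : Fin (m + 1) =>
      A (Fin.cons (α := fun _ => Fin n) a i t) (Fin.snoc (α := fun _ => Fin n) i b t)).prod := by
  induction m generalizing a with
  | zero =>
    simp [Fin.snoc]
  | succ m ih =>
    rw [pow_succ', Matrix.mul_apply]
    simp only [ih, Finset.mul_sum]
    rw [← Finset.sum_product', Finset.univ_product_univ]
    refine Fintype.sum_equiv (Fin.consEquiv fun _ => Fin n) _ _ fun x => ?_
    rw [List.ofFn_succ (n := m + 1), List.prod_cons]
    refine congrArg₂ (· * ·) ?_ ?_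
    · rw [← Fin.castSucc_zero, Fin.consEquiv]
      simp [Fin.snoc]
    · refine congrArg List.prod (congrArg List.ofFn (funext fun t => ?_))
      simp only [Fin.cons_succ, Fin.consEquiv, Equiv.coe_fn_mk]
      rw [← Fin.cons_snoc_eq_snoc_cons, Fin.cons_succ]

theorem trace_pow_eq_sum {n : ℕ} (A : Matrix (Fin n) (Fin n) R) {m : ℕ} (hm : 1 ≤ m) :
    (A ^ m).trace = ∑ i : Fin m → Fin n,
      (List.ofFn fun t => A (i t) (i (finRotate m t))).prod := by
  obtain ⟨m, rfl⟩ := Nat.exists_eq_add_of_le' hm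
  simp only [Matrix.trace, Matrix.diag, pow_apply_eq_sum]
  rw [← Finset.sum_product', Finset.univ_product_univ]
  refine Fintype.sum_equiv (Fin.consEquiv fun _ => Fin n) _ _ fun x => ?_
  congr 1
  refine congrArg List.ofFn (funext fun t => ?_)
  congr 1
  induction t using Fin.lastCases with
  | last => simp [Fin.consEquiv]
  | cast t =>
    rw [Fin.snoc_castSucc, finRotate_apply, Fin.coeSucc_eq_succ]
    simp [Fin.consEquiv]

theorem prod_ofFn_sum {s : ℕ} {ι : Fin s → Type*} [∀ k, Fintype (ι k)]
    (F : ∀ k, ι k → R) :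
    (List.ofFn fun k => ∑ i, F k i).prod = ∑ i : ∀ k, ι k, (List.ofFn fun k => F k (i k)).prod := by
  induction s with
  | zero => simp
  | succ s ih =>
    rw [List.ofFn_succ, List.prod_cons, ih fun k => F k.succ, Finset.sum_mul_sum,
      ← Finset.sum_product', Finset.univ_product_univ]
    refine Fintype.sum_equiv (Fin.consEquiv ι) _ _ fun x => ?_
    rw [List.ofFn_succ, List.prod_cons]
    rfl

theorem finRange_sum_eq_flatten {s : ℕ} (p : Fin s → ℕ) :
    List.finRange (∑ k, p k) =
      (List.ofFn fun k => List.ofFn fun t : Fin (p k) => finSigmaFinEquiv ⟨k, t⟩).flatten := by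
  -- both lists are strictly increasing with the same entries
  have hsort : (List.ofFn fun k => List.ofFn fun t : Fin (p k) =>
      (finSigmaFinEquiv ⟨k, t⟩ : Fin (∑ k, p k))).flatten.Pairwise (· < ·) := by
    rw [List.pairwise_flatten]
    constructor
    · intro l hl
      obtain ⟨k, rfl⟩ := (List.mem_ofFn' _ _).1 hl
      rw [List.pairwise_ofFn]
      exact fun i j hij => finSigmaFinEquiv_lt_iff.2 hij
    · rw [List.pairwise_ofFn]
      intro i j hij x hx y hy
      obtain ⟨t, rfl⟩ := (List.mem_ofFn' _ _).1 hx
      obtain ⟨u, rfl⟩ := (List.mem_ofFn' _ _).1 hy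
      exact finSigmaFinEquiv_lt hij t u
  refine List.Perm.eq_of_pairwise (le := (· < ·)) (fun a b _ _ h1 h2 => absurd h1 h2.asymm)
    (List.pairwise_lt_finRange _) hsort ?_
  refine (List.perm_ext_iff_of_nodup (List.nodup_finRange _)
    (hsort.imp fun h => h.ne)).2 fun v => ?_
  refine ⟨fun _ => ?_, fun _ => List.mem_finRange v⟩
  obtain ⟨⟨k, t⟩, rfl⟩ := finSigmaFinEquiv.surjective v
  exact List.mem_flatten.2 ⟨_, (List.mem_ofFn' _ _).2 ⟨k, rfl⟩, (List.mem_ofFn' _ _).2 ⟨t, rfl⟩⟩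

theorem prod_ofFn_prod_ofFn {s : ℕ} {p : Fin s → ℕ} (G : Fin (∑ k, p k) → R) :
    (List.ofFn fun k => (List.ofFn fun t : Fin (p k) => G (finSigmaFinEquiv ⟨k, t⟩)).prod).prod =
      (List.ofFn G).prod := by
  rw [List.ofFn_eq_map (f := G), finRange_sum_eq_flatten, List.map_flatten, List.prod_flatten,
    List.map_map, List.map_ofFn]
  congr 1
  refine congrArg List.ofFn (funext fun k => ?_)
  simp only [Function.comp_apply, List.map_ofFn]
  rfl

theorem prod_trace_pow_eq_sum {I : Type*} {n s : ℕ} (A : I → Matrix (Fin n) (Fin n) R)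
    (l : Fin s → I) {p : Fin s → ℕ} (hp : ∀ k, 1 ≤ p k) :
    (List.ofFn fun k => (A (l k) ^ p k).trace).prod =
      ∑ i : Fin (∑ k, p k) → Fin n, (List.ofFn fun v =>
        A (l (intervalIndex p v)) (i v) (i (intervalPerm p v))).prod := by
  simp only [fun k => trace_pow_eq_sum (A (l k)) (hp k)]
  rw [prod_ofFn_sum]
  symm
  refine Fintype.sum_equiv ((Equiv.arrowCongr finSigmaFinEquiv.symm (Equiv.refl _)).trans
    (Equiv.piCurry fun _ _ => Fin n)) _ _ fun i => ?_
  rw [← prod_ofFn_prod_ofFn]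
  congr 1
  refine congrArg List.ofFn (funext fun k => ?_)
  congr 1
  refine congrArg List.ofFn (funext fun t => ?_)
  rw [intervalIndex_apply, intervalPerm, sigmaRotate_apply]
  rfl

end Expansion

section Moments

variable {𝒜 I : Type*} [Ring 𝒜] [Algebra ℂ 𝒜] {φ : 𝒜 →ₗ[ℂ] ℂ} {n : ℕ} [NeZero n]
  {A : I → Matrix (Fin n) (Fin n) 𝒜}

open Classical in
theorem multExt_freeCumulant_entries (hA : IsRCyclic φ A) (hind : CyclicCumulantsIndexFree φ A)
    {q : ℕ} (π : Part q) (l : Fin q → I) (γ : Perm (Fin q)) (i : Fin q → Fin n) :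
    multExt (freeCumulant φ) π (fun v => A (l v) (i v) (i (γ v))) =
      if ∀ v, i (γ v) = i (blockPerm π v) then multExt (commonCumulant φ A) π l else 0 := by
  split_ifs with h
  · refine Finset.prod_congr rfl fun V hV => ?_
    have h1 : ∀ t, i (γ (V.orderEmbOfFin rfl t)) =
        i (V.orderEmbOfFin rfl (finRotate V.card t)) := fun t => by rw [h, blockPerm_apply π hV]
    simp only [h1]
    exact hind V.card (fun t => l (V.orderEmbOfFin rfl t)) (fun t => i (V.orderEmbOfFin rfl t))
      fun _ => 0
  · obtain ⟨v, hv⟩ := not_forall.1 h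
    obtain ⟨V, hV, t, rfl⟩ := exists_eq_orderEmbOfFin π v
    refine Finset.prod_eq_zero hV (hA V.card (fun t => l (V.orderEmbOfFin rfl t))
      (fun t => i (V.orderEmbOfFin rfl t)) (fun t => i (γ (V.orderEmbOfFin rfl t))) fun hc => hv ?_)
    rw [blockPerm_apply π hV]
    exact hc t

/-- The moments of the traces `χ(A_{l_k}^{p_k})` as a sum over noncrossing partitions. -/
theorem moment_trace_pow (hA : IsRCyclic φ A) (hind : CyclicCumulantsIndexFree φ A)
    {s : ℕ} (hs : 1 ≤ s) (l : Fin s → I) {p : Fin s → ℕ} (hp : ∀ k, 1 ≤ p k) :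
    φ (List.ofFn fun k => (A (l k) ^ p k).trace).prod =
      ∑ π ∈ NC (∑ k, p k), (n : ℂ) ^ numCycles ((blockPerm π)⁻¹ * intervalPerm p) *
        multExt (commonCumulant φ A) π fun v => l (intervalIndex p v) := by
  classical
  have hpos : 0 < ∑ k, p k :=
    (hp ⟨0, hs⟩).trans (Finset.single_le_sum (fun _ _ => Nat.zero_le _) (Finset.mem_univ _))
  rw [prod_trace_pow_eq_sum A l hp, map_sum]
  simp only [moment_eq_sum_multExt_freeCumulant φ hpos, multExt_freeCumulant_entries hA hind _
    (fun v => l (intervalIndex p v)) (intervalPerm p)]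
  rw [Finset.sum_comm]
  refine Finset.sum_congr rfl fun π _ => ?_
  rw [← Finset.sum_filter, Finset.sum_const, nsmul_eq_mul, ← Nat.cast_pow,
    ← card_filter_comp_eq]
  congr!

end Moments

/-! ### The join of a noncrossing partition with an interval partition -/

/-- A set of indices, given as a predicate `f`, is saturated for a partition `Q` of a set of
positions, `g` assigning an index to each position, if it contains the indices of all or of none
of the positions in each block. -/
def IsSaturated {N s : ℕ} (g : Fin N → Fin s) {S : Finset (Fin N)} (Q : Finpartition S)
    (f : Fin s → Prop) : Prop :=
  ∀ W ∈ Q.parts, ∀ v ∈ W, ∀ w ∈ W, f (g v) → f (g w)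

/-- A partition `Q` of a set `S` of positions connects the indices of `S` if no saturated set of
indices separates them. -/
def IsConnecting {N s : ℕ} (g : Fin N → Fin s) {S : Finset (Fin N)} (Q : Finpartition S) : Prop :=
  ∀ f, IsSaturated g Q f → ∀ v ∈ S, ∀ w ∈ S, f (g v) → f (g w)

/-- The noncrossing condition for a partition of a subset. -/
def IsNoncrossingOn {N : ℕ} {S : Finset (Fin N)} (Q : Finpartition S) : Prop :=
  ∀ V ∈ Q.parts, ∀ W ∈ Q.parts, ∀ a b c d : Fin N,
    a < b → b < c → c < d → a ∈ V → c ∈ V → b ∈ W → d ∈ W → V = W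

/-- The equivalence relation on indices induced by a partition of the positions: two indices are
equivalent if no saturated set separates them. -/
def indexSetoid {N s : ℕ} (g : Fin N → Fin s) (π : Part N) : Setoid (Fin s) where
  r k k' := ∀ f, IsSaturated g π f → (f k ↔ f k')
  iseqv := ⟨fun _ _ _ => Iff.rfl, fun h f hf => (h f hf).symm,
    fun h h' f hf => (h f hf).trans (h' f hf)⟩

theorem toSetoid_rel_iff {N : ℕ} (π : Part N) (v w : Fin N) :
    Part.toSetoid π v w ↔ ∃ W ∈ π.parts, v ∈ W ∧ w ∈ W := by
  rw [Part.toSetoid, Setoid.ker_def,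
    ← π.mem_part_iff_part_eq_part (Finset.mem_univ _) (Finset.mem_univ _), π.mem_part_iff_exists]

theorem numClasses_toSetoid {N : ℕ} (π : Part N) :
    numClasses (Part.toSetoid π) = π.parts.card := by
  rw [← cycleSetoid_blockPerm, ← numCycles_blockPerm, numCycles]

theorem toSetoid_injective {N : ℕ} : Function.Injective (Part.toSetoid (s := N)) := by
  have key : ∀ π ρ : Part N, Part.toSetoid π = Part.toSetoid ρ → π.parts ⊆ ρ.parts := by
    intro π ρ h V hV
    obtain ⟨v, hv⟩ := π.nonempty_of_mem_parts hV
    have : V = ρ.part v := by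
      ext w
      rw [← π.part_eq_of_mem hV hv,
        π.mem_part_iff_part_eq_part (Finset.mem_univ _) (Finset.mem_univ _),
        ρ.mem_part_iff_part_eq_part (Finset.mem_univ _) (Finset.mem_univ _)]
      exact Setoid.ext_iff.1 h w v
    rw [this]
    exact ρ.part_mem.2 (Finset.mem_univ _)
  exact fun π ρ h => Finpartition.ext (Finset.Subset.antisymm (key _ _ h) (key _ _ h.symm))

open Classical in
/-- The partition of the indices induced by a partition of the positions. -/
noncomputable def indexPart {N s : ℕ} (g : Fin N → Fin s) (π : Part N) : Part s :=
  Finpartition.ofSetoid (indexSetoid g π)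

theorem toSetoid_indexPart {N s : ℕ} (g : Fin N → Fin s) (π : Part N) :
    Part.toSetoid (indexPart g π) = indexSetoid g π := by
  classical
  refine Setoid.ext fun k k' => ?_
  rw [Part.toSetoid, Setoid.ker_def,
    ← Finpartition.mem_part_iff_part_eq_part _ (Finset.mem_univ _) (Finset.mem_univ _), indexPart,
    Finpartition.mem_part_ofSetoid_iff_rel]
  exact ⟨Setoid.symm' _, Setoid.symm' _⟩

theorem indexPart_eq_iff {N s : ℕ} {g : Fin N → Fin s} {π : Part N} {σ : Part s} :
    indexPart g π = σ ↔ ∀ k k', indexSetoid g π k k' ↔ ∃ V ∈ σ.parts, k ∈ V ∧ k' ∈ V := by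
  rw [← toSetoid_injective.eq_iff, toSetoid_indexPart, Setoid.ext_iff]
  simp only [toSetoid_rel_iff]

section Join

variable {N s : ℕ} {g : Fin N → Fin s}

/-- The indices reached from a position through the join form a saturated set. -/
theorem isSaturated_join (π : Part N) (v : Fin N) :
    IsSaturated g π fun k => ∃ w, g w = k ∧ (Part.toSetoid π ⊔ Setoid.ker g) v w := by
  rintro W hW a ha b hb ⟨w, hw, hvw⟩
  refine ⟨b, rfl, Setoid.trans' _ hvw (Setoid.trans' _ (y := a) ?_ ?_)⟩
  · exact (le_sup_right : Setoid.ker g ≤ Part.toSetoid π ⊔ Setoid.ker g) hw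
  · exact (le_sup_left : Part.toSetoid π ≤ Part.toSetoid π ⊔ Setoid.ker g)
      ((toSetoid_rel_iff π a b).2 ⟨W, hW, ha, hb⟩)

theorem join_eq_comap (π : Part N) :
    Part.toSetoid π ⊔ Setoid.ker g = (indexSetoid g π).comap g := by
  apply le_antisymm
  · refine sup_le (fun v w h => ?_) fun v w h => ?_
    · obtain ⟨W, hW, hv, hw⟩ := (toSetoid_rel_iff π v w).1 h
      exact fun f hf => ⟨hf W hW v hv w hw, hf W hW w hw v hv⟩
    · have : g v = g w := h
      rw [Setoid.comap_rel, this]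
  · intro v w h
    obtain ⟨u, hu, hvu⟩ := (h _ (isSaturated_join π v)).1 ⟨v, rfl, Setoid.refl' _ v⟩
    exact Setoid.trans' _ hvu
      ((le_sup_right : Setoid.ker g ≤ Part.toSetoid π ⊔ Setoid.ker g) hu)

theorem numClasses_join (hg : Function.Surjective g) (π : Part N) :
    numClasses (Part.toSetoid π ⊔ Setoid.ker g) = (indexPart g π).parts.card := by
  rw [← numClasses_toSetoid, toSetoid_indexPart, join_eq_comap]
  refine Nat.card_congr (Equiv.ofBijective (Quotient.map' g fun _ _ h => h) ⟨?_, ?_⟩)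
  · intro a b
    induction a using Quotient.inductionOn
    induction b using Quotient.inductionOn
    intro h
    have := Quotient.exact (s := indexSetoid g π) h
    exact Quotient.sound this
  · intro b
    induction b using Quotient.inductionOn with
    | h k =>
      obtain ⟨v, rfl⟩ := hg k
      exact ⟨Quotient.mk _ v, rfl⟩

theorem join_eq_top_iff (π : Part N) :
    Part.toSetoid π ⊔ Setoid.ker g = ⊤ ↔ IsConnecting g π := by
  constructor
  · intro h f hf v _ w _ hv
    have : (Part.toSetoid π ⊔ Setoid.ker g) v w := by rw [h]; trivial
    rw [join_eq_comap] at this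
    exact (this f hf).1 hv
  · intro h
    refine Setoid.ext fun v w => ⟨fun _ => trivial, fun _ => ?_⟩
    rw [join_eq_comap]
    exact fun f hf => ⟨h f hf v (Finset.mem_univ _) w (Finset.mem_univ _),
      h f hf w (Finset.mem_univ _) v (Finset.mem_univ _)⟩

/-- The join of a noncrossing partition with an interval partition is noncrossing. -/
theorem isNoncrossing_indexPart (hg : Monotone g) {π : Part N} (hπ : IsNoncrossing π) :
    IsNoncrossing (indexPart g π) := by
  have hlt : ∀ {v w}, g v < g w → v < w := fun h => hg.reflect_lt h
  intro V₁ hV₁ V₂ hV₂ a b c d hab hbc hcd ha hc hb hd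
  by_contra hne
  have hclass : ∀ V ∈ (indexPart g π).parts, ∀ k k', k ∈ V → (k' ∈ V ↔ indexSetoid g π k k') := by
    intro V hV k k' hk
    rw [← toSetoid_indexPart, toSetoid_rel_iff]
    refine ⟨fun h => ⟨V, hV, hk, h⟩, ?_⟩
    rintro ⟨V', hV', h, h'⟩
    rwa [(indexPart g π).eq_of_mem_parts hV hV' hk h]
  -- a class `V` that meets both an interval and its complement has a block that does so
  have hcross : ∀ V ∈ (indexPart g π).parts, ∀ lo hi k k', k ∈ V → k' ∈ V → lo < k → k < hi →
      ¬ (lo < k' ∧ k' < hi) → ∃ W ∈ π.parts, ∃ x ∈ W, ∃ y ∈ W, g x ∈ V ∧ g y ∈ V ∧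
        lo < g x ∧ g x < hi ∧ ¬ (lo < g y ∧ g y < hi) := by
    intro V hV lo hi k k' hk hk' h1 h2 h3
    by_contra hcon
    have hsat : IsSaturated g π fun j => j ∈ V ∧ lo < j ∧ j < hi := by
      rintro W hW x hx y hy ⟨hxV, hx1, hx2⟩
      have hyV : g y ∈ V := (hclass V hV _ _ hxV).2 fun f hf =>
        ⟨hf W hW x hx y hy, hf W hW y hy x hx⟩
      refine ⟨hyV, ?_⟩
      by_contra hy'
      exact hcon ⟨W, hW, x, hx, y, hy, hxV, hyV, hx1, hx2, hy'⟩
    exact h3 ((((hclass V hV _ _ hk).1 hk') _ hsat).1 ⟨hk, h1, h2⟩).2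
  have hdisj : ∀ k ∈ V₁, ∀ k' ∈ V₂, k ≠ k' := fun k hk k' hk' e =>
    hne ((indexPart g π).eq_of_mem_parts hV₁ hV₂ hk (e ▸ hk'))
  -- a block of `V₁` with indices `g x < g y` cannot separate two indices of `V₂`
  have hfinal : ∀ W ∈ π.parts, ∀ x ∈ W, ∀ y ∈ W, g x ∈ V₁ → g y ∈ V₁ →
      ∀ k ∈ V₂, ∀ k' ∈ V₂, g x < k → k < g y → ¬ (g x < k' ∧ k' < g y) → False := by
    intro W hW x hx y hy hxV hyV k hk k' hk' h1 h2 h3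
    obtain ⟨W', hW', x', hx', y', hy', hxV', hyV', h4, h5, h6⟩ :=
      hcross V₂ hV₂ _ _ k k' hk hk' h1 h2 h3
    have hWne : W ≠ W' := by
      rintro rfl
      have : g x' ∈ V₁ := (hclass V₁ hV₁ _ _ hxV).2 fun f hf =>
        ⟨hf W hW x hx x' hx', hf W hW x' hx' x hx⟩
      exact hdisj _ this _ hxV' rfl
    rcases lt_trichotomy (g y') (g x) with h7 | h7 | h7
    · exact hWne (hπ W' hW' W hW y' x x' y (hlt h7) (hlt h4) (hlt h5) hy' hx' hx hy).symm
    · exact hdisj _ hxV _ hyV' h7.symm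
    · rcases lt_trichotomy (g y') (g y) with h8 | h8 | h8
      · exact h6 ⟨h7, h8⟩
      · exact hdisj _ hyV _ hyV' h8.symm
      · exact hWne (hπ W hW W' hW' x x' y y' (hlt h4) (hlt h5) (hlt h8) hx hy hx' hy')
  obtain ⟨W, hW, x, hx, y, hy, hxV, hyV, h1, h2, h3⟩ :=
    hcross V₁ hV₁ b d c a hc ha hbc hcd fun h => absurd hab h.1.asymm
  rcases lt_trichotomy (g y) b with h4 | h4 | h4
  · exact hfinal W hW y hy x hx hyV hxV b hb d hd h4 h1 fun h => absurd h2 h.2.asymm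
  · exact hdisj _ hyV _ hb h4
  · rcases lt_trichotomy (g y) d with h5 | h5 | h5
    · exact h3 ⟨h4, h5⟩
    · exact hdisj _ hyV _ hd h5
    · exact hfinal W hW x hx y hy hxV hyV d hd b hb h2 h5 fun h => absurd h1 h.1.asymm

end Join

/-! ### Gluing noncrossing partitions -/

section Glue

variable {N s : ℕ} {g : Fin N → Fin s}

/-- The positions whose index lies in `V`. -/
def preimageOf (g : Fin N → Fin s) (V : Finset (Fin s)) : Finset (Fin N) :=
  Finset.univ.filter fun v => g v ∈ V

theorem mem_preimageOf {V : Finset (Fin s)} {v : Fin N} : v ∈ preimageOf g V ↔ g v ∈ V := by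
  simp [preimageOf]

/-- The partition obtained by juxtaposing partitions of the preimages of the blocks of `σ`. -/
def glue (σ : Part s) (q : ∀ V : σ.parts, Finpartition (preimageOf g V.1)) : Part N :=
  Finpartition.ofExistsUnique (Finset.univ.biUnion fun V => (q V).parts)
    (fun _ _ => Finset.subset_univ _)
    (fun v _ => by
      have hv : v ∈ preimageOf g (σ.part (g v)) :=
        mem_preimageOf.2 (σ.mem_part_self.2 (Finset.mem_univ _))
      have hV : σ.part (g v) ∈ σ.parts := σ.part_mem.2 (Finset.mem_univ _)
      obtain ⟨W, hW, hvW⟩ := (q ⟨_, hV⟩).exists_mem hv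
      refine ⟨W, ⟨Finset.mem_biUnion.2 ⟨⟨_, hV⟩, Finset.mem_univ _, hW⟩, hvW⟩, ?_⟩
      rintro W' ⟨hW', hvW'⟩
      obtain ⟨⟨V', hV'⟩, -, hW''⟩ := Finset.mem_biUnion.1 hW'
      have : σ.part (g v) = V' :=
        σ.part_eq_of_mem hV' (mem_preimageOf.1 ((q ⟨V', hV'⟩).subset hW'' hvW'))
      subst this
      exact (q _).eq_of_mem_parts hW'' hW hvW' hvW)
    (fun h => by
      obtain ⟨V, -, hV⟩ := Finset.mem_biUnion.1 h
      exact (q V).empty_notMem_parts hV)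

variable {σ : Part s}

theorem mem_glue {q : ∀ V : σ.parts, Finpartition (preimageOf g V.1)} {W : Finset (Fin N)} :
    W ∈ (glue σ q).parts ↔ ∃ V, W ∈ (q V).parts := by
  simp [glue]

theorem eq_of_mem_parts_preimageOf {q : ∀ V : σ.parts, Finpartition (preimageOf g V.1)}
    {V V' : σ.parts} {W : Finset (Fin N)} (h : W ∈ (q V).parts) {v : Fin N} (hv : v ∈ W)
    (hv' : g v ∈ V'.1) : V = V' :=
  Subtype.ext (σ.eq_of_mem_parts V.2 V'.2 (mem_preimageOf.1 ((q V).subset h hv)) hv')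

theorem mem_parts_iff_of_glue (q : ∀ V : σ.parts, Finpartition (preimageOf g V.1)) (V : σ.parts)
    (W : Finset (Fin N)) :
    W ∈ (q V).parts ↔ W ∈ (glue σ q).parts ∧ W ⊆ preimageOf g V.1 := by
  refine ⟨fun h => ⟨mem_glue.2 ⟨V, h⟩, (q V).subset h⟩, ?_⟩
  rintro ⟨h1, h2⟩
  obtain ⟨V', hV'⟩ := mem_glue.1 h1
  obtain ⟨v, hv⟩ := (q V').nonempty_of_mem_parts hV'
  have := eq_of_mem_parts_preimageOf hV' hv (mem_preimageOf.1 (h2 hv))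
  subst this
  exact hV'

theorem glue_injective : Function.Injective (glue (g := g) σ) := by
  intro q q' h
  funext V
  ext W
  rw [mem_parts_iff_of_glue, mem_parts_iff_of_glue, h]

theorem isNoncrossing_glue (hg : Monotone g) (hσ : IsNoncrossing σ)
    {q : ∀ V : σ.parts, Finpartition (preimageOf g V.1)} (hq : ∀ V, IsNoncrossingOn (q V)) :
    IsNoncrossing (glue σ q) := by
  intro W hW W' hW' a b c d hab hbc hcd ha hc hb hd
  obtain ⟨V, hV⟩ := mem_glue.1 hW
  obtain ⟨V', hV'⟩ := mem_glue.1 hW'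
  have m1 : ∀ {v}, v ∈ W → g v ∈ V.1 := fun h => mem_preimageOf.1 ((q V).subset hV h)
  have m2 : ∀ {v}, v ∈ W' → g v ∈ V'.1 := fun h => mem_preimageOf.1 ((q V').subset hV' h)
  by_cases hVV : V = V'
  · subst hVV
    exact hq V W hV W' hV' a b c d hab hbc hcd ha hc hb hd
  · have hne : ∀ {v w}, v ∈ W → w ∈ W' → g v ≠ g w := fun hv hw e =>
      hVV (eq_of_mem_parts_preimageOf hV hv (e ▸ m2 hw))
    exact absurd (Subtype.ext (hσ V.1 V.2 V'.1 V'.2 _ _ _ _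
      (lt_of_le_of_ne (hg hab.le) (hne ha hb)) (lt_of_le_of_ne (hg hbc.le) (hne hc hb).symm)
      (lt_of_le_of_ne (hg hcd.le) (hne hc hd)) (m1 ha) (m1 hc) (m2 hb) (m2 hd))) hVV

theorem indexPart_glue (hg : Function.Surjective g)
    {q : ∀ V : σ.parts, Finpartition (preimageOf g V.1)} (hq : ∀ V, IsConnecting g (q V)) :
    indexPart g (glue σ q) = σ := by
  rw [indexPart_eq_iff]
  intro k k'
  constructor
  · intro h
    have hk : k ∈ σ.part k := σ.mem_part_self.2 (Finset.mem_univ _)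
    have hV : σ.part k ∈ σ.parts := σ.part_mem.2 (Finset.mem_univ _)
    refine ⟨σ.part k, hV, hk, (h (fun j => j ∈ σ.part k) ?_).1 hk⟩
    intro W hW v hv w hw hvk
    obtain ⟨V, hVW⟩ := mem_glue.1 hW
    have : V = ⟨σ.part k, hV⟩ := eq_of_mem_parts_preimageOf hVW hv hvk
    subst this
    exact mem_preimageOf.1 ((q _).subset hVW hw)
  · rintro ⟨V, hV, hk, hk'⟩ f hf
    obtain ⟨v, rfl⟩ := hg k
    obtain ⟨w, rfl⟩ := hg k'
    have hsat : IsSaturated g (q ⟨V, hV⟩) f := fun W hW => hf W (mem_glue.2 ⟨_, hW⟩)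
    exact ⟨hq ⟨V, hV⟩ f hsat v (mem_preimageOf.2 hk) w (mem_preimageOf.2 hk'),
      hq ⟨V, hV⟩ f hsat w (mem_preimageOf.2 hk') v (mem_preimageOf.2 hk)⟩

/-- A noncrossing partition arises by gluing its restrictions over the blocks of the partition it
induces on the indices. -/
theorem exists_glue_eq {π : Part N} (hπ : IsNoncrossing π) (hσ : indexPart g π = σ) :
    ∃ q : ∀ V : σ.parts, Finpartition (preimageOf g V.1),
      (∀ V, IsNoncrossingOn (q V) ∧ IsConnecting g (q V)) ∧ glue σ q = π := by
  rw [indexPart_eq_iff] at hσ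
  -- each block of `π` lies over a block of `σ`
  have hsub : ∀ W ∈ π.parts, ∀ V ∈ σ.parts, ∀ v ∈ W, g v ∈ V → W ⊆ preimageOf g V := by
    intro W hW V hV v hv hvV w hw
    obtain ⟨V', hV', h1, h2⟩ := (hσ (g v) (g w)).1 fun f hf =>
      ⟨hf W hW v hv w hw, hf W hW w hw v hv⟩
    rw [σ.eq_of_mem_parts hV hV' hvV h1]
    exact mem_preimageOf.2 h2
  let q : ∀ V : σ.parts, Finpartition (preimageOf g V.1) := fun V =>
    π.ofSubset (parts := π.parts.filter (· ⊆ preimageOf g V.1)) (Finset.filter_subset _ _) (by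
      ext v
      simp only [Finset.mem_sup, Finset.mem_filter, id]
      constructor
      · rintro ⟨W, ⟨-, h⟩, hv⟩
        exact h hv
      · intro hv
        obtain ⟨W, hW, hvW⟩ := π.exists_mem (Finset.mem_univ v)
        exact ⟨W, ⟨hW, hsub W hW V.1 V.2 v hvW (mem_preimageOf.1 hv)⟩, hvW⟩)
  have hq : ∀ V W, W ∈ (q V).parts ↔ W ∈ π.parts ∧ W ⊆ preimageOf g V.1 := fun V W =>
    Finset.mem_filter
  refine ⟨q, fun V => ⟨?_, ?_⟩, ?_⟩
  · exact fun W hW W' hW' => hπ W ((hq V W).1 hW).1 W' ((hq V W').1 hW').1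
  · intro f hf v hv w hw hfv
    have hsat : IsSaturated g π fun k => k ∈ V.1 ∧ f k := by
      rintro W hW x hx y hy ⟨h1, h2⟩
      have hWV := hsub W hW V.1 V.2 x hx h1
      exact ⟨mem_preimageOf.1 (hWV hy), hf W ((hq V W).2 ⟨hW, hWV⟩) x hx y hy h2⟩
    exact (((hσ (g v) (g w)).2 ⟨V.1, V.2, mem_preimageOf.1 hv, mem_preimageOf.1 hw⟩ _ hsat).1
      ⟨mem_preimageOf.1 hv, hfv⟩).2
  · refine Finpartition.ext (Finset.ext fun W => ?_)
    rw [mem_glue]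
    constructor
    · rintro ⟨V, hV⟩
      exact ((hq V W).1 hV).1
    · intro hW
      obtain ⟨v, hv⟩ := π.nonempty_of_mem_parts hW
      obtain ⟨V, hV, hvV⟩ := σ.exists_mem (Finset.mem_univ (g v))
      exact ⟨⟨V, hV⟩, (hq _ W).2 ⟨hW, hsub W hW V hV v hv hvV⟩⟩

theorem prod_glue (q : ∀ V : σ.parts, Finpartition (preimageOf g V.1)) (w : Finset (Fin N) → ℂ) :
    ∏ W ∈ (glue σ q).parts, w W = ∏ V : σ.parts, ∏ W ∈ (q V).parts, w W := by
  refine Finset.prod_biUnion fun V _ V' _ hne => ?_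
  rw [Function.onFun, Finset.disjoint_left]
  intro W hW hW'
  obtain ⟨v, hv⟩ := (q V).nonempty_of_mem_parts hW
  exact hne (eq_of_mem_parts_preimageOf hW hv (mem_preimageOf.1 ((q V').subset hW' hv)))

open Classical in
/-- The noncrossing partitions with a prescribed join with the interval partition are obtained by
choosing, independently over each block of the join, a connecting noncrossing partition. -/
theorem sum_filter_indexPart (hg : Monotone g) (hg' : Function.Surjective g)
    (hσ : IsNoncrossing σ) (w : Finset (Fin N) → ℂ) :
    ∑ π ∈ (NC N).filter (fun π => indexPart g π = σ), ∏ W ∈ π.parts, w W =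
      ∏ V ∈ σ.parts, ∑ Q : Finpartition (preimageOf g V) with
        IsNoncrossingOn Q ∧ IsConnecting g Q, ∏ W ∈ Q.parts, w W := by
  rw [← Finset.prod_coe_sort, Finset.prod_univ_sum]
  symm
  refine Finset.sum_nbij (glue σ) ?_ glue_injective.injOn ?_ fun q _ => (prod_glue q w).symm
  · intro q hq
    rw [Fintype.mem_piFinset] at hq
    simp only [Finset.mem_filter, Finset.mem_univ, true_and] at hq
    rw [Finset.mem_filter, NC, Finset.mem_filter]
    exact ⟨⟨Finset.mem_univ _, isNoncrossing_glue hg hσ fun V => (hq V).1⟩,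
      indexPart_glue hg' fun V => (hq V).2⟩
  · intro π hπ
    rw [Finset.mem_coe, Finset.mem_filter, NC, Finset.mem_filter] at hπ
    obtain ⟨q, hq, rfl⟩ := exists_glue_eq hπ.1.2 hπ.2
    refine ⟨q, ?_, rfl⟩
    rw [Finset.mem_coe, Fintype.mem_piFinset]
    exact fun V => Finset.mem_filter.2 ⟨Finset.mem_univ _, hq V⟩

end Glue

/-! ### Transport of partitions along order embeddings -/

theorem apply_orderEmbOfFin_congr {X α : Type*} [LinearOrder α] (f : (r : ℕ) → (Fin r → X) → ℂ)
    (x : α → X) {m : ℕ} {V : Finset α} (h : V.card = m) :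
    f V.card (fun t => x (V.orderEmbOfFin rfl t)) = f m (fun t => x (V.orderEmbOfFin h t)) := by
  subst h
  rfl

theorem apply_orderEmbOfFin_map {X α β : Type*} [LinearOrder α] [LinearOrder β]
    (f : (r : ℕ) → (Fin r → X) → ℂ) (x : β → X) (E : α ↪o β) (W : Finset α) :
    f (W.map E.toEmbedding).card (fun t => x ((W.map E.toEmbedding).orderEmbOfFin rfl t)) =
      f W.card (fun t => x (E (W.orderEmbOfFin rfl t))) := by
  have hc : (W.map E.toEmbedding).card = W.card := Finset.card_map _
  rw [apply_orderEmbOfFin_congr f x hc]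
  congr 1
  funext t
  congr 1
  exact (congrFun (Finset.orderEmbOfFin_unique hc (f := fun t => E (W.orderEmbOfFin rfl t))
    (fun t => Finset.mem_map_of_mem E.toEmbedding (W.orderEmbOfFin_mem rfl t))
    (E.strictMono.comp (W.orderEmbOfFin rfl).strictMono)) t).symm

section Transfer

variable {M N : ℕ}

/-- The image of a partition under an order embedding, a partition of the range. -/
def mapPart (E : Fin M ↪o Fin N) {S : Finset (Fin N)}
    (hS : Finset.univ.map E.toEmbedding = S) (π : Part M) : Finpartition S :=
  Finpartition.ofExistsUnique (π.parts.map (Finset.mapEmbedding E.toEmbedding).toEmbedding)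
    (by
      intro W hW
      obtain ⟨V, -, rfl⟩ := Finset.mem_map.1 hW
      rw [← hS]
      exact Finset.map_subset_map.2 (Finset.subset_univ V))
    (by
      intro v hv
      rw [← hS] at hv
      obtain ⟨a, -, rfl⟩ := Finset.mem_map.1 hv
      obtain ⟨V, hV, ha⟩ := π.exists_mem (Finset.mem_univ a)
      refine ⟨V.map E.toEmbedding, ⟨Finset.mem_map_of_mem _ hV, Finset.mem_map_of_mem _ ha⟩, ?_⟩
      rintro W' ⟨hW', ha'⟩
      obtain ⟨V', hV', rfl⟩ := Finset.mem_map.1 hW'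
      rw [π.eq_of_mem_parts hV hV' ha ((Finset.mem_map' _).1 ha')]
      rfl)
    (by
      intro h
      obtain ⟨V, hV, hV'⟩ := Finset.mem_map.1 h
      exact π.ne_empty hV (Finset.map_eq_empty.1 hV'))

variable {E : Fin M ↪o Fin N} {S : Finset (Fin N)} {hS : Finset.univ.map E.toEmbedding = S}

theorem mem_mapPart {π : Part M} {W : Finset (Fin N)} :
    W ∈ (mapPart E hS π).parts ↔ ∃ V ∈ π.parts, V.map E.toEmbedding = W := by
  simp [mapPart]

theorem mapPart_injective : Function.Injective (mapPart E hS) := fun _ _ h =>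
  Finpartition.ext (Finset.map_injective _ (congrArg Finpartition.parts h))

theorem mapPart_surjective : Function.Surjective (mapPart E hS) := by
  classical
  intro Q
  let pre : Finset (Fin N) → Finset (Fin M) := fun W => Finset.univ.filter fun a => E a ∈ W
  have hmem : ∀ a, E a ∈ S := fun a => hS ▸ Finset.mem_map_of_mem E.toEmbedding (Finset.mem_univ a)
  have hpre : ∀ W ∈ Q.parts, (pre W).map E.toEmbedding = W := by
    intro W hW
    ext v
    rw [Finset.mem_map]
    constructor
    · rintro ⟨a, ha, rfl⟩
      exact (Finset.mem_filter.1 ha).2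
    · intro hv
      have := Q.subset hW hv
      rw [← hS] at this
      obtain ⟨a, -, rfl⟩ := Finset.mem_map.1 this
      exact ⟨a, Finset.mem_filter.2 ⟨Finset.mem_univ _, hv⟩, rfl⟩
  let π : Part M := Finpartition.ofExistsUnique (Q.parts.image pre)
    (fun _ _ => Finset.subset_univ _)
    (by
      intro a _
      obtain ⟨W, hW, ha⟩ := Q.exists_mem (hmem a)
      refine ⟨pre W, ⟨Finset.mem_image_of_mem _ hW,
        Finset.mem_filter.2 ⟨Finset.mem_univ _, ha⟩⟩, ?_⟩
      rintro V ⟨hV, haV⟩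
      obtain ⟨W', hW', rfl⟩ := Finset.mem_image.1 hV
      rw [Q.eq_of_mem_parts hW hW' ha (Finset.mem_filter.1 haV).2])
    (by
      intro h
      obtain ⟨W, hW, hW'⟩ := Finset.mem_image.1 h
      have := hpre W hW
      rw [hW', Finset.map_empty] at this
      exact Q.ne_empty hW this.symm)
  refine ⟨π, Finpartition.ext (Finset.ext fun W => ?_)⟩
  rw [mem_mapPart]
  constructor
  · rintro ⟨V, hV, rfl⟩
    obtain ⟨W, hW, rfl⟩ := Finset.mem_image.1 hV
    rwa [hpre W hW]
  · exact fun hW => ⟨pre W, Finset.mem_image_of_mem _ hW, hpre W hW⟩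

theorem isNoncrossingOn_mapPart {π : Part M} :
    IsNoncrossingOn (mapPart E hS π) ↔ IsNoncrossing π := by
  constructor
  · intro h V hV W hW a b c d hab hbc hcd ha hc hb hd
    exact Finset.map_injective E.toEmbedding (h _ (mem_mapPart.2 ⟨V, hV, rfl⟩) _
      (mem_mapPart.2 ⟨W, hW, rfl⟩) (E a) (E b) (E c) (E d) (E.lt_iff_lt.2 hab) (E.lt_iff_lt.2 hbc)
      (E.lt_iff_lt.2 hcd) (Finset.mem_map_of_mem E.toEmbedding ha)
      (Finset.mem_map_of_mem E.toEmbedding hc) (Finset.mem_map_of_mem E.toEmbedding hb)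
      (Finset.mem_map_of_mem E.toEmbedding hd))
  · intro h W hW W' hW' a b c d hab hbc hcd ha hc hb hd
    obtain ⟨V, hV, rfl⟩ := mem_mapPart.1 hW
    obtain ⟨V', hV', rfl⟩ := mem_mapPart.1 hW'
    obtain ⟨a, ha', rfl⟩ := Finset.mem_map.1 ha
    obtain ⟨b, hb', rfl⟩ := Finset.mem_map.1 hb
    obtain ⟨c, hc', rfl⟩ := Finset.mem_map.1 hc
    obtain ⟨d, hd', rfl⟩ := Finset.mem_map.1 hd
    rw [h V hV V' hV' a b c d (E.lt_iff_lt.1 hab) (E.lt_iff_lt.1 hbc) (E.lt_iff_lt.1 hcd) ha' hc'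
      hb' hd']

theorem isConnecting_mapPart {r s : ℕ} {g : Fin N → Fin s} {g' : Fin M → Fin r}
    (e : Fin r → Fin s) (he : Function.Injective e) (hE : ∀ v, g (E v) = e (g' v)) {π : Part M} :
    IsConnecting g (mapPart E hS π) ↔ IsConnecting g' π := by
  have hmem : ∀ a, E a ∈ S := fun a => hS ▸ Finset.mem_map_of_mem E.toEmbedding (Finset.mem_univ a)
  constructor
  · intro h f hf v _ w _ hv
    have hsat : IsSaturated g (mapPart E hS π) fun k => ∃ j, e j = k ∧ f j := by
      rintro W hW x hx y hy ⟨j, hj, hfj⟩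
      obtain ⟨V, hV, rfl⟩ := mem_mapPart.1 hW
      obtain ⟨x, hx', rfl⟩ := Finset.mem_map.1 hx
      obtain ⟨y, hy', rfl⟩ := Finset.mem_map.1 hy
      have hj' : e j = e (g' x) := hj.trans (hE x)
      refine ⟨g' y, (hE y).symm, hf V hV x hx' y hy' ?_⟩
      rwa [← he hj']
    obtain ⟨j, hj, hfj⟩ := h _ hsat (E v) (hmem v) (E w) (hmem w) ⟨g' v, (hE v).symm, hv⟩
    rwa [← he (hj.trans (hE w))]
  · intro h f hf v hv w hw hfv
    rw [← hS] at hv hw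
    obtain ⟨v, -, rfl⟩ := Finset.mem_map.1 hv
    obtain ⟨w, -, rfl⟩ := Finset.mem_map.1 hw
    have hsat : IsSaturated g' π fun j => f (e j) := by
      intro V hV x hx y hy hfx
      rw [← hE] at hfx ⊢
      exact hf _ (mem_mapPart.2 ⟨V, hV, rfl⟩) _ (Finset.mem_map_of_mem _ hx) _
        (Finset.mem_map_of_mem _ hy) hfx
    have := h _ hsat v (Finset.mem_univ _) w (Finset.mem_univ _)
    rw [← hE, ← hE] at this
    exact this hfv

end Transfer

/-! ### Restriction to a set of intervals -/

section Restrict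

variable {s : ℕ} (p : Fin s → ℕ) (V : Finset (Fin s))

/-- The restriction of lengths `p₁, …, p_s` to the indices in `V`. -/
def restrictLengths : Fin V.card → ℕ := fun t => p (V.orderEmbOfFin rfl t)

/-- The map on pairs (index, position within the interval) induced by the increasing enumeration
of `V`. -/
def sigmaEmb (x : Σ t, Fin (restrictLengths p V t)) : Σ k, Fin (p k) :=
  ⟨V.orderEmbOfFin rfl x.1, x.2⟩

/-- The order embedding of the positions belonging to the indices in `V` into all positions. -/
def positionEmb : Fin (∑ t, restrictLengths p V t) ↪o Fin (∑ k, p k) :=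
  OrderEmbedding.ofStrictMono
    (fun v => finSigmaFinEquiv (sigmaEmb p V (finSigmaFinEquiv.symm v))) <| by
    intro v w h
    obtain ⟨⟨k, t⟩, rfl⟩ := finSigmaFinEquiv.surjective v
    obtain ⟨⟨k', t'⟩, rfl⟩ := finSigmaFinEquiv.surjective w
    simp only [Equiv.symm_apply_apply]
    rcases lt_trichotomy k k' with hk | rfl | hk
    · exact finSigmaFinEquiv_lt ((V.orderEmbOfFin rfl).strictMono hk) _ _
    · exact finSigmaFinEquiv_lt_iff.2 (finSigmaFinEquiv_lt_iff.1 h)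
    · exact absurd h (finSigmaFinEquiv_lt hk _ _).asymm

theorem intervalIndex_positionEmb (v : Fin (∑ t, restrictLengths p V t)) :
    intervalIndex p (positionEmb p V v) =
      V.orderEmbOfFin rfl (intervalIndex (restrictLengths p V) v) :=
  intervalIndex_apply p _ _

theorem map_positionEmb :
    Finset.univ.map (positionEmb p V).toEmbedding = preimageOf (intervalIndex p) V := by
  ext v
  rw [mem_preimageOf, Finset.mem_map]
  constructor
  · rintro ⟨w, -, rfl⟩
    have := intervalIndex_positionEmb p V w
    exact this ▸ V.orderEmbOfFin_mem rfl _
  · intro hv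
    obtain ⟨⟨k, t⟩, rfl⟩ := finSigmaFinEquiv.surjective v
    rw [intervalIndex_apply] at hv
    have hr : k ∈ Set.range (V.orderEmbOfFin rfl) := by
      rw [Finset.range_orderEmbOfFin]; exact hv
    obtain ⟨j, rfl⟩ := hr
    refine ⟨finSigmaFinEquiv ⟨j, t⟩, Finset.mem_univ _, ?_⟩
    show finSigmaFinEquiv (sigmaEmb p V (finSigmaFinEquiv.symm (finSigmaFinEquiv ⟨j, t⟩))) = _
    rw [Equiv.symm_apply_apply]
    rfl

open Classical in
theorem sum_NCJoinTop_restrict (w : Finset (Fin (∑ k, p k)) → ℂ) :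
    ∑ π ∈ NCJoinTop (restrictLengths p V),
        ∏ W ∈ π.parts, w (W.map (positionEmb p V).toEmbedding) =
      ∑ Q : Finpartition (preimageOf (intervalIndex p) V) with
        IsNoncrossingOn Q ∧ IsConnecting (intervalIndex p) Q, ∏ W ∈ Q.parts, w W := by
  have hiff : ∀ π : Part (∑ t, restrictLengths p V t), π ∈ NCJoinTop (restrictLengths p V) ↔
      IsNoncrossingOn (mapPart (positionEmb p V) (map_positionEmb p V) π) ∧
      IsConnecting (intervalIndex p) (mapPart (positionEmb p V) (map_positionEmb p V) π) := by
    intro π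
    rw [isNoncrossingOn_mapPart, isConnecting_mapPart _ (V.orderEmbOfFin rfl).injective
      (intervalIndex_positionEmb p V), ← join_eq_top_iff, NCJoinTop, Finset.mem_filter, NC,
      Finset.mem_filter]
    simp only [Finset.mem_univ, true_and]
    rfl
  refine Finset.sum_nbij (mapPart (positionEmb p V) (map_positionEmb p V)) ?_
    mapPart_injective.injOn ?_ fun π _ => ?_
  · exact fun π hπ => Finset.mem_filter.2 ⟨Finset.mem_univ _, (hiff π).1 hπ⟩
  · intro Q hQ
    obtain ⟨π, rfl⟩ := mapPart_surjective (hS := map_positionEmb p V) Q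
    exact ⟨π, (hiff π).2 (Finset.mem_filter.1 hQ).2, rfl⟩
  · rw [mapPart, Finpartition.ofExistsUnique_parts, Finset.prod_map]
    rfl

theorem sum_restrictLengths : ∑ t, restrictLengths p V t = ∑ k ∈ V, p k := by
  rw [← Finset.sum_coe_sort V]
  exact Fintype.sum_equiv (V.orderIsoOfFin rfl).toEquiv _ _ fun _ => rfl

end Restrict

/-! ### The moment-cumulant formula for the right-hand side -/

/-- The right-hand side of the cumulant formula, for the multiplicative extension of an arbitrary
sequence of functions `f`, an `s`-tuple of letters and exponents being given. -/
noncomputable def connectedSum {I : Type*} (n : ℕ) (f : (r : ℕ) → (Fin r → I) → ℂ) (s : ℕ)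
    (x : Fin s → I × {m : ℕ // 1 ≤ m}) : ℂ :=
  (n : ℂ) ^ (((∑ k, ((x k).2 : ℕ) : ℕ) : ℤ) + 2 - (s : ℤ)) *
    ∑ π ∈ NCJoinTop fun k => ((x k).2 : ℕ), (n : ℂ) ^ (-(π.parts.card : ℤ)) *
      multExt f π fun v => (x (intervalIndex (fun k => ((x k).2 : ℕ)) v)).1

theorem zpow_neg_card_mul_multExt {I : Type*} (n : ℕ) (f : (r : ℕ) → (Fin r → I) → ℂ) {N : ℕ}
    (π : Part N) (y : Fin N → I) :
    (n : ℂ) ^ (-(π.parts.card : ℤ)) * multExt f π y =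
      ∏ W ∈ π.parts, (n : ℂ)⁻¹ * f W.card (fun t => y (W.orderEmbOfFin rfl t)) := by
  rw [Finset.prod_mul_distrib, Finset.prod_const, zpow_neg, zpow_natCast, inv_pow]
  rfl

theorem zpow_sum {ι : Type*} {c : ℂ} (hc : c ≠ 0) (S : Finset ι) (e : ι → ℤ) :
    c ^ (∑ i ∈ S, e i) = ∏ i ∈ S, c ^ e i := by
  classical
  induction S using Finset.induction_on with
  | empty => simp
  | insert a S ha ih => rw [Finset.sum_insert ha, Finset.prod_insert ha, zpow_add₀ hc, ih]

theorem sum_NC_eq_sum_multExt_connectedSum {I : Type*} {n : ℕ} (hn : n ≠ 0)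
    (f : (r : ℕ) → (Fin r → I) → ℂ) {s : ℕ} (hs : 1 ≤ s) (x : Fin s → I × {m : ℕ // 1 ≤ m}) :
    ∑ π ∈ NC (∑ k, ((x k).2 : ℕ)), (n : ℂ) ^ numCycles
        ((blockPerm π)⁻¹ * intervalPerm fun k => ((x k).2 : ℕ)) *
        multExt f π (fun v => (x (intervalIndex (fun k => ((x k).2 : ℕ)) v)).1) =
      ∑ σ ∈ NC s, multExt (connectedSum n f) σ x := by
  classical
  set p : Fin s → ℕ := fun k => ((x k).2 : ℕ) with hp
  have hp1 : ∀ k, 1 ≤ p k := fun k => (x k).2.2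
  set g := intervalIndex p
  have hg : Monotone g := intervalIndex_monotone p
  have hg' : Function.Surjective g := fun k => ⟨finSigmaFinEquiv ⟨k, ⟨0, hp1 k⟩⟩,
    intervalIndex_apply p k _⟩
  have hn' : (n : ℂ) ≠ 0 := Nat.cast_ne_zero.2 hn
  set w : Finset (Fin (∑ k, p k)) → ℂ := fun W =>
    (n : ℂ)⁻¹ * f W.card (fun t => (x (g (W.orderEmbOfFin rfl t))).1) with hw
  have hmaps : ∀ π ∈ NC (∑ k, p k), indexPart g π ∈ NC s := fun π hπ =>
    Finset.mem_filter.2 ⟨Finset.mem_univ _,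
      isNoncrossing_indexPart hg (Finset.mem_filter.1 hπ).2⟩
  rw [← Finset.sum_fiberwise_of_maps_to hmaps]
  refine Finset.sum_congr rfl fun σ hσ => ?_
  -- the exponent of `n` splits over the blocks of `σ`
  have hterm : ∀ π ∈ (NC (∑ k, p k)).filter (fun π => indexPart g π = σ),
      (n : ℂ) ^ numCycles ((blockPerm π)⁻¹ * intervalPerm p) *
        multExt f π (fun v => (x (g v)).1) =
      (n : ℂ) ^ (∑ V ∈ σ.parts, (((∑ k ∈ V, p k : ℕ) : ℤ) + 2 - (V.card : ℤ))) *
        ∏ W ∈ π.parts, w W := by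
    intro π hπ
    obtain ⟨hπ1, hπ2⟩ := Finset.mem_filter.1 hπ
    have hcount := numCycles_blockPerm_inv_mul hs hp1 (Finset.mem_filter.1 hπ1).2
    have hjoin : numClasses (Part.toSetoid π ⊔ intervalSetoid p) = σ.parts.card := by
      rw [← hπ2]; exact numClasses_join hg' π
    have hsum1 : ∑ V ∈ σ.parts, ∑ k ∈ V, p k = ∑ k, p k := by
      conv_rhs => rw [← σ.biUnion_parts]
      exact (Finset.sum_biUnion σ.disjoint).symm
    have hsum2 : ∑ V ∈ σ.parts, V.card = s := by simpa using σ.sum_card_parts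
    have hexp : (numCycles ((blockPerm π)⁻¹ * intervalPerm p) : ℤ) =
        (∑ V ∈ σ.parts, (((∑ k ∈ V, p k : ℕ) : ℤ) + 2 - (V.card : ℤ))) +
          -(π.parts.card : ℤ) := by
      rw [Finset.sum_sub_distrib, Finset.sum_add_distrib, ← Nat.cast_sum, ← Nat.cast_sum, hsum1,
        hsum2, Finset.sum_const, nsmul_eq_mul]
      rw [hjoin] at hcount
      omega
    rw [← zpow_natCast, hexp, zpow_add₀ hn', mul_assoc, zpow_neg_card_mul_multExt]
  rw [Finset.sum_congr rfl hterm, ← Finset.mul_sum,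
    sum_filter_indexPart hg hg' (Finset.mem_filter.1 hσ).2, zpow_sum hn',
    ← Finset.prod_mul_distrib, multExt]
  refine Finset.prod_congr rfl fun V _ => ?_
  rw [connectedSum, ← sum_restrictLengths p V, ← sum_NCJoinTop_restrict p V w]
  refine congrArg₂ (· * ·) rfl (Finset.sum_congr rfl fun π _ => ?_)
  refine Eq.trans ?_ (zpow_neg_card_mul_multExt n f π fun v => (x (V.orderEmbOfFin rfl
    (intervalIndex (restrictLengths p V) v))).1).symm
  refine Finset.prod_congr rfl fun W _ => ?_
  rw [hw]
  simp only
  rw [apply_orderEmbOfFin_map f (fun v => (x (g v)).1) (positionEmb p V) W]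
  simp only [g, intervalIndex_positionEmb]

/-- A sequence of functions is determined by the sums of its multiplicative extensions over
noncrossing partitions. -/
theorem eq_of_sum_multExt_eq {X : Type*} {f f' : (r : ℕ) → (Fin r → X) → ℂ}
    (h : ∀ s, 1 ≤ s → ∀ x : Fin s → X, ∑ π ∈ NC s, multExt f π x = ∑ π ∈ NC s, multExt f' π x)
    (s : ℕ) (hs : 1 ≤ s) (x : Fin s → X) : f s x = f' s x := by
  classical
  induction s using Nat.strong_induction_on with
  | _ s ih =>
    have hne : (Finset.univ : Finset (Fin s)) ≠ ⊥ :=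
      (Finset.univ_nonempty_iff.2 ⟨⟨0, hs⟩⟩).ne_empty
    set τ : Part s := Finpartition.indiscrete hne
    have hτp : τ.parts = {Finset.univ} := rfl
    have hτ : τ ∈ NC s := by
      refine Finset.mem_filter.2 ⟨Finset.mem_univ _, fun V hV W hW _ _ _ _ _ _ _ _ _ _ _ => ?_⟩
      rw [hτp, Finset.mem_singleton] at hV hW
      rw [hV, hW]
    have htop : ∀ F : (r : ℕ) → (Fin r → X) → ℂ, multExt F τ x = F s x := by
      intro F
      have hc : (Finset.univ : Finset (Fin s)).card = s := by simp
      have hid : ∀ t, (Finset.univ : Finset (Fin s)).orderEmbOfFin hc t = t := fun t =>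
        (congrFun (Finset.orderEmbOfFin_unique hc (f := id) (fun _ => Finset.mem_univ _)
          strictMono_id) t).symm
      rw [multExt, hτp, Finset.prod_singleton, apply_orderEmbOfFin_congr F x hc]
      simp only [hid]
    have hrest : ∑ π ∈ (NC s).erase τ, multExt f π x = ∑ π ∈ (NC s).erase τ, multExt f' π x := by
      refine Finset.sum_congr rfl fun π hπ => Finset.prod_congr rfl fun V hV => ?_
      have hnot : Finset.univ ∉ π.parts := by
        intro hu
        refine Finset.ne_of_mem_erase hπ (Finpartition.ext ?_)
        rw [hτp]
        refine Finset.eq_singleton_iff_unique_mem.2 ⟨hu, fun W hW => ?_⟩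
        obtain ⟨v, hv⟩ := π.nonempty_of_mem_parts hW
        exact π.eq_of_mem_parts hW hu hv (Finset.mem_univ v)
      exact ih V.card (card_lt_of_univ_notMem hnot hV)
        (Finset.card_pos.2 (π.nonempty_of_mem_parts hV)) _
    have := h s hs x
    rw [← Finset.add_sum_erase _ _ hτ, ← Finset.add_sum_erase _ _ hτ, hrest, htop, htop] at this
    exact add_right_cancel this

end FreeProb

theorem mainTheorem2 {𝒜 I : Type*} [Ring 𝒜] [Algebra ℂ 𝒜] (φ : 𝒜 →ₗ[ℂ] ℂ) (hφ : φ 1 = 1)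
    (n : ℕ) [NeZero n] (A : I → Matrix (Fin n) (Fin n) 𝒜)
    (hA : FreeProb.IsRCyclic φ A) (hind : FreeProb.CyclicCumulantsIndexFree φ A)
    (s : ℕ) (hs : 1 ≤ s) (l : Fin s → I) (p : Fin s → ℕ) (hp : ∀ k, 1 ≤ p k) :
    FreeProb.freeCumulant φ s (fun k => (A (l k) ^ p k).trace) =
      (n : ℂ) ^ (((∑ k, p k : ℕ) : ℤ) + 2 - (s : ℤ)) *
        ∑ π ∈ FreeProb.NCJoinTop p,
          (n : ℂ) ^ (-(π.parts.card : ℤ)) *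
            FreeProb.multExt (FreeProb.commonCumulant φ A) π
              (fun v => l (FreeProb.intervalIndex p v)) := by
  refine FreeProb.eq_of_sum_multExt_eq (X := I × {m : ℕ // 1 ≤ m})
    (f := fun r x => FreeProb.freeCumulant φ r fun k => (A (x k).1 ^ ((x k).2 : ℕ)).trace)
    (f' := FreeProb.connectedSum n (FreeProb.commonCumulant φ A)) (fun r hr x => ?_) s hs
    fun k => (l k, ⟨p k, hp k⟩)
  rw [← FreeProb.sum_NC_eq_sum_multExt_connectedSum (NeZero.ne n) _ hr x,
    ← FreeProb.moment_trace_pow hA hind hr (fun k => (x k).1) fun k => (x k).2.2]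
  exact (FreeProb.moment_eq_sum_multExt_freeCumulant φ hr
    fun k => (A (x k).1 ^ ((x k).2 : ℕ)).trace).symm
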